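/- Let $\alpha>0$ and $r\in\mathbb R$, put $\lambda=r/\alpha$, and let $n,M,p$ be integers with $n-1<\alpha\le n<M$ and $1\le p\le M$. The left and right Riemann–Liouville derivatives of order $\alpha$ are, with $\nu=\lfloor\alpha\rfloor+1$, $$D^\alpha_{x-}f(x)=\frac1{\Gamma(\nu-\alpha)}\frac{d^\nu}{dx^\nu}\int_{-\infty}^x\frac{f(t)\,dt}{(x-t)^{\alpha+1-\nu}},\qquad D^\alpha_{x+}f(x)=\frac{(-1)^\nu}{\Gamma(\nu-\alpha)}\frac{d^\nu}{dx^\nu}\int_x^\infty\frac{f(t)\,dt}{(t-x)^{\alpha+1-\nu}} .$$ A real sequence $(w_k)_{k\ge0}$ (or its generating function $\sum_k w_kz^k$) is said to approximate $D^\alpha_{x\mp}$ with shift $r$ and order $p$ if, for every $f\in C^{M+n+1}(\mathbb R)$ with $f^{(k)}\in L_1(\mathbb R)$ for $0\le k\le M+n+1$ and every $x\in\mathbb R$, $$D^\alpha_{x\mp}f(x)=\frac1{h^\alpha}\sum_{k=0}^\infty w_k f(x\mp(k-r)h)+O(h^p)\qquad(h\to0^+).$$ For $0\le j\le p$ let (all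 indices running in $\{0,\dots,p\}$) $$b_j=-\Bigl(\prod_{m\ne j}\frac1{j-m}\Bigr)\sum_{m\ne j}\ \prod_{l\ne m,j}(\lambda-l).$$ (1) Let $\beta_0,\dots,\beta_p\in\mathbb R$ and let $(w_k)$ be a real sequence with $\sum_k|w_k|<\infty$ and generating function $W_{p,r}(z)=\sum_k w_kz^k=(\beta_0+\beta_1z+\cdots+\beta_pz^p)^\alpha$ for all $z\in[0,1)$, with the principal value of the power. Then $W_{p,r}$ approximates the left fractional derivative $D^\alpha_{x-}$ with shift $r$ and order $p$ if and only if $\beta_j=b_j$ for $j=0,\dots,p$, or, in case $\alpha$ is an even integer (so that the sign of the polynomial does not affect $W_{p,r}$), $\beta_j=-b_j$ for $j=0,\dots,p$. The same equivalence holds for the right fractional derivative $D^\alpha_{x+}$. (2) For every $j$ such that $\lambda\ne m$ for all $m\in\{0,\dots,p\}\setminus\{j\}$, $$b_j=-\Bigl(\prod_{m\ne j}\frac{\lambda-m}{j-m}\Bigr)\sum_{m\ne j}\frac1{\lambda-m}.$$ (3) If $r=0$, then $b_0+b_1z+\cdots+b_pz^p=\sum_{j=1}^p\frac1j(1-z)^j$,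 so that the generating function is Lubich's $\bigl(\sum_{j=1}^p\frac1j(1-z)^j\bigr)^\alpha$. -/

import Mathlib

open Filter Topology Asymptotics

namespace Grunwald

noncomputable section

/-- The left Riemann–Liouville derivative of order `α > 0` on the real line,
`1 / Γ(n - α) * dⁿ/dxⁿ ∫_{-∞}^x f(t) / (x - t)^(α + 1 - n) dt` with `n = ⌊α⌋ + 1`. For a natural
number `α` the kernel is `1` and this is the ordinary derivative of order `α`. -/
def leftDeriv (α : ℝ) (f : ℝ → ℝ) (x : ℝ) : ℝ :=
  1 / Real.Gamma ((⌊α⌋₊ + 1 : ℕ) - α) *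
    iteratedDeriv (⌊α⌋₊ + 1)
      (fun y => ∫ t in Set.Iio y, f t / (y - t) ^ (α + 1 - ((⌊α⌋₊ + 1 : ℕ) : ℝ))) x

/-- The right Riemann–Liouville derivative of order `α > 0` on the real line,
`(-1)ⁿ / Γ(n - α) * dⁿ/dxⁿ ∫_x^∞ f(t) / (t - x)^(α + 1 - n) dt` with `n = ⌊α⌋ + 1`. -/
def rightDeriv (α : ℝ) (f : ℝ → ℝ) (x : ℝ) : ℝ :=
  (-1) ^ (⌊α⌋₊ + 1) / Real.Gamma ((⌊α⌋₊ + 1 : ℕ) - α) *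
    iteratedDeriv (⌊α⌋₊ + 1)
      (fun y => ∫ t in Set.Ioi y, f t / (t - y) ^ (α + 1 - ((⌊α⌋₊ + 1 : ℕ) : ℝ))) x

/-- The left Grünwald type operator with weights `w`, shift `r` and step `h`. -/
def leftDiff (α r : ℝ) (w : ℕ → ℝ) (h : ℝ) (f : ℝ → ℝ) (x : ℝ) : ℝ :=
  1 / h ^ α * ∑' k : ℕ, w k * f (x - ((k : ℝ) - r) * h)

/-- The right Grünwald type operator with weights `w`, shift `r` and step `h`. -/
def rightDiff (α r : ℝ) (w : ℕ → ℝ) (h : ℝ) (f : ℝ → ℝ) (x : ℝ) : ℝ :=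
  1 / h ^ α * ∑' k : ℕ, w k * f (x + ((k : ℝ) - r) * h)

/-- Functions of class `C^N` on the line all of whose derivatives up to order `N` are
Lebesgue integrable. -/
def IsSmoothIntegrable (N : ℕ) (f : ℝ → ℝ) : Prop :=
  ContDiff ℝ N f ∧ ∀ k ≤ N, MeasureTheory.Integrable (iteratedDeriv k f)

/-- The weights `w` approximate the left derivative of order `α` with shift `r` and order `p`:
for all functions of the class above (with parameter `N`), at every point, the error is `O(h^p)`
as the step `h` decreases to `0`. -/
def ApproximatesLeft (α r : ℝ) (p N : ℕ) (w : ℕ → ℝ) : Prop :=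
  ∀ f : ℝ → ℝ, IsSmoothIntegrable N f → ∀ x : ℝ,
    (fun h : ℝ => leftDeriv α f x - leftDiff α r w h f x) =O[𝓝[>] 0] fun h : ℝ => h ^ p

/-- The weights `w` approximate the right derivative of order `α` with shift `r` and
order `p`. -/
def ApproximatesRight (α r : ℝ) (p N : ℕ) (w : ℕ → ℝ) : Prop :=
  ∀ f : ℝ → ℝ, IsSmoothIntegrable N f → ∀ x : ℝ,
    (fun h : ℝ => rightDeriv α f x - rightDiff α r w h f x) =O[𝓝[>] 0] fun h : ℝ => h ^ p

/-- The polynomial `β₀ + β₁ z + ⋯ + β_p z^p`. -/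
def basePoly (p : ℕ) (β : ℕ → ℝ) (z : ℂ) : ℂ :=
  ∑ j ∈ Finset.range (p + 1), (β j : ℂ) * z ^ j

/-- `∑ w_k z^k` is the generating function `(β₀ + ⋯ + β_p z^p)^α` with real coefficients `w_k`.
The identity, with the principal value of the power, is asked for on `[0, 1)`; this determines `w`.
It is not asked for at the other points of the unit disc, where the polynomial may cross the cut of
the principal value. When `α` is a natural number, the identity says that `∑ w_k z^k` is the
ordinary power of the polynomial. -/
def IsPowerGenerating (α : ℝ) (p : ℕ) (β w : ℕ → ℝ) : Prop :=
  ∀ x : ℝ, 0 ≤ x → x < 1 →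
    HasSum (fun k : ℕ => (w k : ℂ) * (x : ℂ) ^ k) (basePoly p β (x : ℂ) ^ (α : ℂ))

/-- The closed form
`- (∏_{m ≠ j} 1 / (j - m)) * ∑_{m ≠ j} ∏_{l ≠ m, j} (lam - l)`, indices in `{0, …, p}`. -/
def betaCoeff (p : ℕ) (lam : ℝ) (j : ℕ) : ℝ :=
  -(∏ m ∈ (Finset.range (p + 1)).erase j, 1 / ((j : ℝ) - m)) *
    ∑ m ∈ (Finset.range (p + 1)).erase j,
      ∏ l ∈ ((Finset.range (p + 1)).erase j).erase m, (lam - l)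

/-- The closed form
`- (∏_{m ≠ j} (lam - m) / (j - m)) * ∑_{m ≠ j} 1 / (lam - m)`, indices in `{0, …, p}`;
meaningful when `lam ≠ m` for all `m ≠ j`. -/
def betaCoeff' (p : ℕ) (lam : ℝ) (j : ℕ) : ℝ :=
  -(∏ m ∈ (Finset.range (p + 1)).erase j, (lam - m) / ((j : ℝ) - m)) *
    ∑ m ∈ (Finset.range (p + 1)).erase j, 1 / (lam - m)

/-- The polynomial `∑_{j=1}^p (1 - z)^j / j`, whose power `α` is Lubich's generating function. -/
def lubichPoly (p : ℕ) (z : ℂ) : ℂ :=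
  ∑ j ∈ Finset.Icc 1 p, (1 / (j : ℂ)) * (1 - z) ^ j

end

end Grunwald

namespace Grunwald

open MeasureTheory

/-! Put `q(h) = ∑ β_j e^{(λ-j)h}`. Since `e^{rh} = (e^{λh})^α`, the symbol `e^{rh} W(e^{-h})` of the
difference operator is `q(h)^α`. Order `p` therefore amounts to `(q(h)/h)^α = 1 + O(h^p)`, that is,
`q(h) = h + O(h^{p+1})`. This prescribes the moments `∑ β_j (λ-j)^k` for `k ≤ p`: they are `1` for
`k = 1` and `0` otherwise. The system is of Vandermonde type, so its solution is unique; it is given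
by minus the derivatives at `λ` of the Lagrange basis on `0, …, p` (`sum_betaCoeff_mul_pow`,
`eq_betaCoeff_of_isBigO`).

Necessity (`eq_betaCoeff_of_approximatesLeft`): tested at `0` on a smooth cutoff of `e^x`, the
derivative is `1` and the difference operator is exactly `h^{-α} q(h)^α`, so an `α`-th root yields
the condition on `q`. If `q < 0` near `0+`, the principal value contributes the factor `e^{iπα}`,
which must be `1`; then `α` is even and `-β` is the solution.

Sufficiency: for `α = n` the generating function is a polynomial and Taylor's formula suffices
(`approximatesLeft_natCast`). For `α < n` both operators are Fourier multipliers; their symbols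
differ by `O(h^p |ω|^{α+p})` (`exists_symbol_bound`), and this is integrable against the Fourier
transform of `f` (`approximatesLeft_of_lt`).

The right derivative follows by reflection. Lubich's polynomial is the truncated series of
`-log(1-y)` at `y = 1 - e^{-h}`, so it satisfies the same condition on `q` when `λ = 0`. -/

/-! ### The coefficients: Lagrange interpolation and moments. -/

lemma betaCoeff_eq_derivative (p : ℕ) (lam : ℝ) (j : ℕ) :
    betaCoeff p lam j = -(Polynomial.derivative
      (Lagrange.basis (Finset.range (p + 1)) (fun i : ℕ => (i : ℝ)) j)).eval lam := by
  unfold betaCoeff Lagrange.basis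
  rw [Polynomial.derivative_prod_finset, Polynomial.eval_finsetSum, neg_mul, Finset.mul_sum]
  congr 1
  refine Finset.sum_congr rfl fun m hm => ?_
  simp only [Lagrange.basisDivisor, Polynomial.derivative_mul, Polynomial.derivative_C, zero_mul,
    zero_add, Polynomial.derivative_sub, Polynomial.derivative_X, sub_zero, mul_one,
    Polynomial.eval_mul, Polynomial.eval_C, Polynomial.eval_prod, Polynomial.eval_sub,
    Polynomial.eval_X, Finset.prod_mul_distrib]
  rw [← Finset.mul_prod_erase _ (fun m : ℕ => 1 / ((j : ℝ) - m)) hm]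
  simp only [one_div]
  ring

/-- The moments of the coefficients up to order `p`. -/
lemma sum_betaCoeff_mul_pow (p : ℕ) (lam : ℝ) {k : ℕ} (hk : k ≤ p) :
    ∑ j ∈ Finset.range (p + 1), betaCoeff p lam j * (lam - j) ^ k = if k = 1 then 1 else 0 := by
  have hinj : Set.InjOn (fun i : ℕ => (i : ℝ)) (Finset.range (p + 1) : Finset ℕ) :=
    fun a _ b _ h => Nat.cast_injective h
  have hdeg : ((Polynomial.C lam - Polynomial.X : Polynomial ℝ) ^ k).degree
      < ((Finset.range (p + 1)).card : WithBot ℕ) := by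
    refine lt_of_le_of_lt (Polynomial.degree_pow_le _ _) ?_
    have h1 : (Polynomial.C lam - Polynomial.X : Polynomial ℝ).degree ≤ 1 := by
      refine (Polynomial.degree_sub_le _ _).trans (max_le (Polynomial.degree_C_le.trans ?_) ?_)
      · exact zero_le_one
      · exact Polynomial.degree_X_le
    refine lt_of_le_of_lt (nsmul_le_nsmul_right h1 k) ?_
    simp only [nsmul_eq_mul, mul_one, Finset.card_range]
    exact_mod_cast Nat.lt_succ_of_le hk
  -- Interpolation of `(λ - X)^k` at `p + 1` nodes is exact for `k ≤ p`; its derivative at `λ` is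
  -- `-1` for `k = 1` and `0` otherwise.
  have h := congrArg (fun q => (Polynomial.derivative q).eval lam)
    (Lagrange.eq_interpolate hinj hdeg)
  simp only [Lagrange.interpolate_apply, Polynomial.derivative_sum, Polynomial.eval_finsetSum,
    Polynomial.derivative_mul, Polynomial.derivative_C, zero_mul, zero_add, Polynomial.eval_mul,
    Polynomial.eval_C, Polynomial.derivative_pow, Polynomial.eval_pow, Polynomial.eval_sub,
    Polynomial.eval_X, Polynomial.derivative_sub, Polynomial.derivative_X, zero_sub, sub_self,
    Polynomial.eval_neg, mul_neg, mul_one] at h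
  simp only [betaCoeff_eq_derivative, neg_mul, Finset.sum_neg_distrib]
  simp only [mul_comm _ ((lam - _) ^ k)]
  rw [← h, neg_neg]
  rcases k with _ | _ | k <;> simp

/-- Vandermonde: the nodes `λ - j` are distinct, so `p + 1` moments determine `p + 1` coefficients.
-/
lemma eq_of_moments {p : ℕ} {lam : ℝ} {β γ : ℕ → ℝ}
    (h : ∀ k ≤ p, ∑ j ∈ Finset.range (p + 1), β j * (lam - j) ^ k
      = ∑ j ∈ Finset.range (p + 1), γ j * (lam - j) ^ k) :
    ∀ j ≤ p, β j = γ j := by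
  have := Matrix.eq_zero_of_forall_pow_sum_mul_pow_eq_zero
    (f := fun j : Fin (p + 1) => lam - (j : ℕ)) (v := fun j => β j - γ j)
    (fun a b hab => Fin.ext (by simpa using hab)) (fun k => by
      have h1 := h k (Nat.lt_succ_iff.1 k.2)
      rw [Fin.sum_univ_eq_sum_range (fun j => (β j - γ j) * (lam - j) ^ (k : ℕ))]
      simp only [sub_mul, Finset.sum_sub_distrib, h1, sub_self])
  intro j hj
  exact sub_eq_zero.1 (congrFun this ⟨j, Nat.lt_succ_of_le hj⟩)

/-! ### Exponential sums near the origin. -/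

/-- A polynomial of degree less than `N` that is `O(h ^ N)` as `h → 0` vanishes. -/
lemma eq_zero_of_sum_isBigO_pow {l : Filter ℝ} [l.NeBot] (hl : l ≤ 𝓝[>] 0) (N : ℕ) :
    ∀ a : ℕ → ℝ, ((fun h : ℝ => ∑ k ∈ Finset.range N, a k * h ^ k) =O[l] fun h => h ^ N) →
      ∀ k < N, a k = 0 := by
  have hl0 : l ≤ 𝓝 0 := hl.trans nhdsWithin_le_nhds
  induction N with
  | zero => intro a _ k hk; omega
  | succ N ih =>
    intro a ha
    have h0 : a 0 = 0 := by
      have t1 : Tendsto (fun h : ℝ => ∑ k ∈ Finset.range (N + 1), a k * h ^ k) l (𝓝 (a 0)) := by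
        have : Continuous (fun h : ℝ => ∑ k ∈ Finset.range (N + 1), a k * h ^ k) := by fun_prop
        have := (this.tendsto 0).mono_left hl0
        simpa [Finset.sum_range_succ'] using this
      have t2 : Tendsto (fun h : ℝ => h ^ (N + 1)) l (𝓝 0) := by
        have := ((continuous_pow (M := ℝ) (N + 1)).tendsto 0).mono_left hl0
        simpa using this
      exact tendsto_nhds_unique t1 (ha.trans_tendsto t2)
    have hne : ∀ᶠ h : ℝ in l, 0 < h := hl self_mem_nhdsWithin
    have h1 : (fun h : ℝ => ∑ k ∈ Finset.range N, a (k + 1) * h ^ k) =O[l] fun h => h ^ N := by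
      have := (isBigO_refl (fun h : ℝ => h⁻¹) l).mul ha
      refine (this.congr' ?_ ?_)
      · filter_upwards [hne] with h hh
        rw [Finset.sum_range_succ', h0, Finset.sum_congr rfl fun k _ => show
          a (k + 1) * h ^ (k + 1) = h * (a (k + 1) * h ^ k) by ring, ← Finset.mul_sum]
        field_simp
        simp
      · filter_upwards [hne] with h hh
        rw [pow_succ]; field_simp
    intro k hk
    rcases k with _ | k
    · exact h0
    · exact ih _ h1 k (by omega)

/-- The Taylor coefficients of an exponential sum are its moments divided by factorials. -/
lemma sum_mul_exp_sub_isBigO {ι : Type*} (s : Finset ι) (c μ : ι → ℝ) (N : ℕ) :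
    (fun h : ℝ => ∑ j ∈ s, c j * Real.exp (μ j * h)
      - ∑ k ∈ Finset.range N, ((∑ j ∈ s, c j * μ j ^ k) / k.factorial) * h ^ k)
      =O[𝓝 0] fun h => h ^ N := by
  have : ∀ j ∈ s, (fun h : ℝ => c j * (Real.exp (μ j * h) -
      ∑ k ∈ Finset.range N, (μ j * h) ^ k / k.factorial)) =O[𝓝 0] fun h => h ^ N := by
    intro j _
    have ht : Tendsto (fun h : ℝ => μ j * h) (𝓝 0) (𝓝 0) := by
      have : Continuous (fun h : ℝ => μ j * h) := by fun_prop
      simpa using this.tendsto 0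
    have h1 := (Real.exp_sub_sum_range_isBigO_pow N).comp_tendsto ht
    refine (h1.trans ?_).const_mul_left _
    simp only [Function.comp_def, mul_pow]
    exact (isBigO_refl _ _).const_mul_left _
  refine (IsBigO.fun_sum this).congr_left fun h => ?_
  simp only [mul_sub, Finset.sum_sub_distrib, Finset.mul_sum, Finset.sum_div, Finset.sum_mul]
  rw [Finset.sum_comm (s := s)]
  congr 1
  refine Finset.sum_congr rfl fun k _ => Finset.sum_congr rfl fun j _ => ?_
  rw [mul_pow]; ring

lemma sum_mul_cexp_sub_isBigO {ι : Type*} (s : Finset ι) (c μ : ι → ℝ) (N : ℕ) :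
    (fun h : ℂ => ∑ j ∈ s, (c j : ℂ) * Complex.exp (μ j * h)
      - ∑ k ∈ Finset.range N, (((∑ j ∈ s, c j * μ j ^ k) / k.factorial : ℝ) : ℂ) * h ^ k)
      =O[𝓝 0] fun h => h ^ N := by
  have : ∀ j ∈ s, (fun h : ℂ => (c j : ℂ) * (Complex.exp (μ j * h) -
      ∑ k ∈ Finset.range N, (μ j * h) ^ k / k.factorial)) =O[𝓝 0] fun h => h ^ N := by
    intro j _
    have ht : Tendsto (fun h : ℂ => μ j * h) (𝓝 0) (𝓝 0) := by
      have : Continuous (fun h : ℂ => μ j * h) := by fun_prop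
      simpa using this.tendsto 0
    have h1 := (Complex.exp_sub_sum_range_isBigO_pow N).comp_tendsto ht
    refine (h1.trans ?_).const_mul_left _
    simp only [Function.comp_def, mul_pow]
    exact (isBigO_refl _ _).const_mul_left _
  refine (IsBigO.fun_sum this).congr_left fun h => ?_
  push_cast
  simp only [mul_sub, Finset.sum_sub_distrib, Finset.mul_sum, Finset.sum_div, Finset.sum_mul]
  rw [Finset.sum_comm (s := s)]
  congr 1
  refine Finset.sum_congr rfl fun k _ => Finset.sum_congr rfl fun j _ => ?_
  rw [mul_pow]; ring

/-- Only the first moment survives. A general field `R` serves the real and the complex expansions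
at once. -/
lemma sum_moment_betaCoeff {R : Type*} [Field R] [Algebra ℝ R] {p : ℕ} (hp : 1 ≤ p) (lam : ℝ)
    (h : R) :
    ∑ k ∈ Finset.range (p + 1), algebraMap ℝ R ((∑ j ∈ Finset.range (p + 1),
      betaCoeff p lam j * (lam - j) ^ k) / k.factorial) * h ^ k = h := by
  rw [Finset.sum_eq_single 1]
  · rw [sum_betaCoeff_mul_pow p lam hp]; simp
  · intro k hk hk1
    rw [sum_betaCoeff_mul_pow p lam (by simpa [Nat.lt_succ_iff] using hk), if_neg hk1]; simp
  · intro h1; simp at h1; omega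

lemma sum_betaCoeff_mul_exp_sub_isBigO {p : ℕ} (hp : 1 ≤ p) (lam : ℝ) :
    (fun h : ℝ => ∑ j ∈ Finset.range (p + 1), betaCoeff p lam j * Real.exp ((lam - j) * h) - h)
      =O[𝓝 0] fun h => h ^ (p + 1) := by
  refine (sum_mul_exp_sub_isBigO (Finset.range (p + 1)) (betaCoeff p lam)
    (fun j => lam - j) (p + 1)).congr_left fun h => ?_
  congr 1
  exact sum_moment_betaCoeff hp lam h

lemma sum_betaCoeff_mul_cexp_sub_isBigO {p : ℕ} (hp : 1 ≤ p) (lam : ℝ) :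
    (fun h : ℂ => ∑ j ∈ Finset.range (p + 1), (betaCoeff p lam j : ℂ) *
      Complex.exp (((lam - j : ℝ) : ℂ) * h) - h) =O[𝓝 0] fun h => h ^ (p + 1) := by
  refine (sum_mul_cexp_sub_isBigO (Finset.range (p + 1)) (betaCoeff p lam)
    (fun j => lam - j) (p + 1)).congr_left fun h => ?_
  congr 1
  exact sum_moment_betaCoeff hp lam h

/-- The exponential sum `∑ β_j e^{(λ - j) h}` determines its coefficients from its behaviour at
`0` up to order `p`. -/
lemma eq_betaCoeff_of_isBigO {p : ℕ} (hp : 1 ≤ p) {lam : ℝ} {β : ℕ → ℝ} {l : Filter ℝ} [l.NeBot]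
    (hl : l ≤ 𝓝[>] 0)
    (h : (fun h : ℝ => ∑ j ∈ Finset.range (p + 1), β j * Real.exp ((lam - j) * h) - h)
      =O[l] fun h => h ^ (p + 1)) : ∀ j ≤ p, β j = betaCoeff p lam j := by
  have hl0 : l ≤ 𝓝 0 := hl.trans nhdsWithin_le_nhds
  have h1 := (sum_mul_exp_sub_isBigO (Finset.range (p + 1)) (fun j => β j - betaCoeff p lam j)
    (fun j => lam - j) (p + 1)).mono hl0
  have h2 := (h.sub ((sum_betaCoeff_mul_exp_sub_isBigO hp lam).mono hl0)).sub h1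
  have h3 := eq_zero_of_sum_isBigO_pow hl (p + 1) _ (h2.congr_left fun h => by
    simp only [sub_mul, Finset.sum_sub_distrib]
    rw [sub_sub_sub_cancel_right, sub_sub_cancel])
  refine eq_of_moments (lam := lam) fun k hk => ?_
  have := h3 k (by omega)
  rw [div_eq_zero_iff] at this
  rcases this with h | h
  · simpa only [sub_mul, Finset.sum_sub_distrib, sub_eq_zero] using h
  · exact absurd h (by positivity)

/-! ### The second closed form and Lubich's polynomial. -/

lemma betaCoeff_eq_betaCoeff' {p : ℕ} {lam : ℝ} {j : ℕ}
    (h : ∀ l ≤ p, l ≠ j → lam ≠ l) : betaCoeff p lam j = betaCoeff' p lam j := by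
  unfold betaCoeff betaCoeff'
  simp only [div_eq_mul_inv, Finset.prod_mul_distrib, one_mul, Finset.mul_sum]
  refine Finset.sum_congr rfl fun m hm => ?_
  rw [← Finset.mul_prod_erase _ (fun m : ℕ => lam - (m : ℝ)) hm]
  have : lam - m ≠ 0 := by
    simp only [Finset.mem_erase, Finset.mem_range] at hm
    exact sub_ne_zero.2 (h m (by omega) hm.1)
  field_simp

lemma sum_Icc_one {M : Type*} [AddCommMonoid M] (f : ℕ → M) (p : ℕ) :
    ∑ j ∈ Finset.Icc 1 p, f j = ∑ i ∈ Finset.range p, f (i + 1) := by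
  induction p with
  | zero => simp
  | succ p ih => rw [Finset.sum_Icc_succ_top (by omega), ih, Finset.sum_range_succ]

/-- With `y = 1 - e^{-h}`, the sum `∑ y^j / j` truncates `-log(1-y) = h` with error `O(y^{p+1}) =
O(h^{p+1})`, and this expansion determines the coefficients. -/
lemma basePoly_betaCoeff_zero {p : ℕ} (hp : 1 ≤ p) (z : ℂ) :
    basePoly p (betaCoeff p 0) z = lubichPoly p z := by
  set L : Polynomial ℝ := ∑ j ∈ Finset.Icc 1 p,
    Polynomial.C (1 / (j : ℝ)) * (1 - Polynomial.X) ^ j with hL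
  have hdeg : L.natDegree < p + 1 := by
    refine Nat.lt_succ_of_le (Polynomial.natDegree_sum_le_of_forall_le _ _ fun j hj => ?_)
    refine (Polynomial.natDegree_C_mul_le _ _).trans (Polynomial.natDegree_pow_le.trans ?_)
    have : (1 - Polynomial.X : Polynomial ℝ).natDegree ≤ 1 :=
      (Polynomial.natDegree_sub_le _ _).trans (by simp)
    calc j * _ ≤ j * 1 := Nat.mul_le_mul_left _ this
      _ ≤ p := by rw [mul_one]; exact (Finset.mem_Icc.1 hj).2
  have hb : ∀ j ≤ p, L.coeff j = betaCoeff p 0 j := by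
    refine eq_betaCoeff_of_isBigO hp (l := 𝓝[>] 0) le_rfl ?_
    have hy : Tendsto (fun h : ℝ => 1 - Real.exp (-h)) (𝓝 0) (𝓝 0) := by
      have : Continuous (fun h : ℝ => 1 - Real.exp (-h)) := by fun_prop
      simpa using this.tendsto 0
    have hyO : (fun h : ℝ => 1 - Real.exp (-h)) =O[𝓝 0] fun h => h := by
      have := (Real.exp_sub_sum_range_isBigO_pow 1).comp_tendsto
        (show Tendsto (fun h : ℝ => -h) (𝓝 0) (𝓝 0) by simpa using (continuous_neg.tendsto (0:ℝ)))
      simp only [Function.comp_def, Finset.sum_range_one, pow_zero, Nat.factorial_zero,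
        Nat.cast_one, div_one, pow_one] at this
      refine (this.neg_left.congr_left fun h => by ring).trans ?_
      exact (isBigO_refl _ _).neg_left
    have key : (fun y : ℝ => ∑ i ∈ Finset.range p, y ^ (i + 1) / ((i : ℝ) + 1) + Real.log (1 - y))
        =O[𝓝 0] fun y => y ^ (p + 1) := by
      -- The remainder is at most `|y|^{p+1} / (1 - |y|)`, and `1 - |y| ≥ 1/2` on the ball chosen.
      refine IsBigO.of_bound 2 ?_
      filter_upwards [Metric.ball_mem_nhds (0 : ℝ) (show (0:ℝ) < 1 / 2 by norm_num)] with y hy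
      rw [mem_ball_zero_iff, Real.norm_eq_abs] at hy
      refine (Real.abs_log_sub_add_sum_range_le (by linarith) p).trans ?_
      rw [Real.norm_eq_abs, abs_pow, div_le_iff₀ (by linarith)]
      nlinarith [pow_nonneg (abs_nonneg y) (p + 1)]
    refine ((key.comp_tendsto hy).trans (hyO.pow (p + 1))).mono nhdsWithin_le_nhds |>.congr_left ?_
    intro h
    simp only [Function.comp_def, sub_sub_cancel, Real.log_exp]
    rw [← sub_eq_add_neg]
    congr 1
    have : ∀ j : ℕ, Real.exp ((0 - (j : ℝ)) * h) = Real.exp (-h) ^ j := fun j => by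
      rw [← Real.exp_nat_mul]; congr 1; ring
    simp only [this]
    rw [← Polynomial.eval_eq_sum_range' hdeg, hL, Polynomial.eval_finsetSum, sum_Icc_one]
    refine Finset.sum_congr rfl fun j _ => ?_
    simp
    ring
  have hz : (L.map (algebraMap ℝ ℂ)).eval z = lubichPoly p z := by
    simp [hL, lubichPoly, Polynomial.map_sum, Polynomial.eval_finsetSum]
  rw [← hz, Polynomial.eval_eq_sum_range' (n := p + 1)
    (lt_of_le_of_lt Polynomial.natDegree_map_le hdeg)]
  refine Finset.sum_congr rfl fun j hj => ?_
  rw [Polynomial.coeff_map, hb j (by simpa [Nat.lt_succ_iff] using hj)]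
  rfl

/-! ### Necessity: the truncated exponential as test function. -/

lemma setIntegral_Iio_eq_Ioi {E : Type*} [NormedAddCommGroup E] [NormedSpace ℝ E]
    (g : ℝ → E) (y : ℝ) : ∫ t in Set.Iio y, g t = ∫ u in Set.Ioi 0, g (y - u) := by
  have h1 : MeasurePreserving (fun u : ℝ => y - u) := Measure.measurePreserving_sub_left volume y
  have h2 : MeasurableEmbedding (fun u : ℝ => y - u) :=
    (Homeomorph.subLeft y).measurableEmbedding
  rw [← h1.setIntegral_preimage_emb h2]
  congr 2
  ext u
  simp

/-- A function which agrees with `exp` on `(-∞, 1)` and vanishes on `(2, ∞)`. -/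
noncomputable def truncExp (y : ℝ) : ℝ := Real.exp y * Real.smoothTransition (2 - y)

lemma truncExp_eq_exp {y : ℝ} (hy : y < 1) : truncExp y = Real.exp y := by
  rw [truncExp, Real.smoothTransition.one_of_one_le (by linarith), mul_one]

lemma truncExp_eq_zero {y : ℝ} (hy : 2 < y) : truncExp y = 0 := by
  rw [truncExp, Real.smoothTransition.zero_of_nonpos (by linarith), mul_zero]

lemma contDiff_truncExp {N : ℕ} : ContDiff ℝ N truncExp :=
  Real.contDiff_exp.mul (Real.smoothTransition.contDiff.comp (contDiff_const.sub contDiff_id))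

lemma isSmoothIntegrable_truncExp (N : ℕ) : IsSmoothIntegrable N truncExp := by
  refine ⟨contDiff_truncExp, fun k _ => ?_⟩
  have hc : Continuous (iteratedDeriv k truncExp) :=
    (contDiff_truncExp (N := k)).continuous_iteratedDeriv k le_rfl
  have h1 : IntegrableOn (iteratedDeriv k truncExp) (Set.Iio 1) := by
    refine (integrableOn_exp_Iic 1 |>.mono_set Set.Iio_subset_Iic_self).congr_fun
      (fun y hy => ?_) measurableSet_Iio
    have : truncExp =ᶠ[𝓝 y] Real.exp := by
      filter_upwards [Iio_mem_nhds hy] with z hz using truncExp_eq_exp hz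
    rw [this.iteratedDeriv_eq, iteratedDeriv_eq_iterate, Real.iter_deriv_exp]
  have h2 : IntegrableOn (iteratedDeriv k truncExp) (Set.Icc 1 2) :=
    hc.continuousOn.integrableOn_Icc
  have h3 : IntegrableOn (iteratedDeriv k truncExp) (Set.Ioi 2) := by
    refine (integrableOn_zero).congr_fun (fun y hy => ?_) measurableSet_Ioi
    have : truncExp =ᶠ[𝓝 y] fun _ => 0 := by
      filter_upwards [Ioi_mem_nhds hy] with z hz using truncExp_eq_zero hz
    rw [this.iteratedDeriv_eq]
    rcases k with _ | k <;> simp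
  rw [← integrableOn_univ]
  refine ((h1.union h2).union h3).mono_set fun y _ => ?_
  rcases lt_or_ge y 1 with h | h
  · exact Or.inl (Or.inl h)
  · rcases le_or_gt y 2 with h' | h'
    · exact Or.inl (Or.inr ⟨h, h'⟩)
    · exact Or.inr h'

/-- For `y < 1` the integral sees only values to the left of `y`, where the function is `exp`;
substituting `u = y - t` leaves `Γ(a) e^y`. The cutoff, needed for integrability at `+∞`, plays no
role. -/
lemma leftDeriv_truncExp (α : ℝ) : leftDeriv α truncExp 0 = 1 := by
  have ha : 0 < ((⌊α⌋₊ + 1 : ℕ) : ℝ) - α := by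
    push_cast; linarith [Nat.lt_floor_add_one α]
  set a := ((⌊α⌋₊ + 1 : ℕ) : ℝ) - α with ha'
  have key : (fun y => ∫ t in Set.Iio y, truncExp t / (y - t) ^ (α + 1 - ((⌊α⌋₊ + 1 : ℕ) : ℝ)))
      =ᶠ[𝓝 0] fun y => Real.Gamma a * Real.exp y := by
    filter_upwards [Iio_mem_nhds (show (0 : ℝ) < 1 by norm_num)] with y hy
    rw [setIntegral_Iio_eq_Ioi, Real.Gamma_eq_integral ha, ← integral_mul_const]
    refine setIntegral_congr_fun measurableSet_Ioi fun u hu => ?_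
    simp only [Set.mem_Ioi, Set.mem_Iio] at hu hy
    rw [truncExp_eq_exp (by linarith), sub_sub_cancel, sub_eq_add_neg, Real.exp_add,
      show α + 1 - ((⌊α⌋₊ + 1 : ℕ) : ℝ) = -(a - 1) by rw [ha']; ring, Real.rpow_neg hu.le]
    simp
    ring
  unfold leftDeriv
  rw [key.iteratedDeriv_eq, iteratedDeriv_const_mul_field, iteratedDeriv_eq_iterate,
    Real.iter_deriv_exp, Real.exp_zero, mul_one, one_div,
    inv_mul_cancel₀ (Real.Gamma_pos_of_pos ha).ne']

/-- All sample points are at most `r h < 1`, so the sum is the generating function at `e^{-h}`. -/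
lemma leftDiff_truncExp (α r : ℝ) (w : ℕ → ℝ) :
    ∀ᶠ h in 𝓝[>] (0 : ℝ), leftDiff α r w h truncExp 0
      = 1 / h ^ α * (Real.exp (r * h) * ∑' k : ℕ, w k * Real.exp (-h) ^ k) := by
  have h1 : ∀ᶠ h in 𝓝[>] (0 : ℝ), r * h < 1 := by
    have : Tendsto (fun h : ℝ => r * h) (𝓝[>] 0) (𝓝 0) := by
      have : Continuous fun h : ℝ => r * h := by fun_prop
      simpa using (this.tendsto 0).mono_left nhdsWithin_le_nhds
    exact this.eventually_lt_const one_pos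
  filter_upwards [h1, self_mem_nhdsWithin] with h hr hh
  simp only [Set.mem_Ioi] at hh
  unfold leftDiff
  congr 1
  rw [← tsum_mul_left]
  refine tsum_congr fun k => ?_
  have hk : 0 ≤ (k : ℝ) * h := by positivity
  rw [truncExp_eq_exp (by linarith), ← Real.exp_nat_mul, mul_left_comm, ← Real.exp_add]
  congr 2
  ring

lemma basePoly_ofReal (p : ℕ) (β : ℕ → ℝ) (x : ℝ) :
    basePoly p β (x : ℂ) = ((∑ j ∈ Finset.range (p + 1), β j * x ^ j : ℝ) : ℂ) := by
  simp [basePoly]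

/-- The generating function at `e^{-h}`, normalized by `e^{r h}`, in terms of an exponential
sum. -/
lemma exp_mul_tsum_eq {α r : ℝ} (hα : 0 < α) {p : ℕ} {β w : ℕ → ℝ}
    (hw : IsPowerGenerating α p β w) {h : ℝ} (hh : 0 < h) :
    ((Real.exp (r * h) * ∑' k : ℕ, w k * Real.exp (-h) ^ k : ℝ) : ℂ) =
      ((∑ j ∈ Finset.range (p + 1), β j * Real.exp ((r / α - j) * h) : ℝ) : ℂ) ^ (α : ℂ) := by
  have h1 := hw (Real.exp (-h)) (Real.exp_pos _).le (Real.exp_zero ▸ Real.exp_lt_exp.2 (by linarith))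
  rw [basePoly_ofReal] at h1
  have h2 := h1.tsum_eq
  have h3 : (∑ j ∈ Finset.range (p + 1), β j * Real.exp ((r / α - j) * h)) =
      Real.exp (r / α * h) * ∑ j ∈ Finset.range (p + 1), β j * Real.exp (-h) ^ j := by
    rw [Finset.mul_sum]
    refine Finset.sum_congr rfl fun j _ => ?_
    rw [← Real.exp_nat_mul, mul_left_comm, ← Real.exp_add]
    congr 2
    ring
  set B := ∑ j ∈ Finset.range (p + 1), β j * Real.exp (-h) ^ j
  have h4 : Real.exp (r * h) = Real.exp (r / α * h) ^ α := by
    rw [← Real.exp_mul]; congr 1; field_simp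
  rw [Complex.ofReal_mul, h3, h4]
  have h5 : ((∑' k : ℕ, w k * Real.exp (-h) ^ k : ℝ) : ℂ) = (B : ℂ) ^ (α : ℂ) := by
    rw [← h2]; push_cast; rfl
  rw [h5]
  have he := (Real.exp_pos (r / α * h)).le
  -- A positive factor leaves the argument unchanged: for `B < 0` both powers carry the same factor
  -- `e^{iπα}`.
  rcases le_or_gt 0 B with hB | hB
  · rw [← Complex.ofReal_cpow hB, ← Complex.ofReal_cpow (mul_nonneg he hB), Real.mul_rpow he hB,
      Complex.ofReal_mul]
  · rw [Complex.ofReal_cpow_of_nonpos hB.le,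
      Complex.ofReal_cpow_of_nonpos (mul_nonpos_of_nonneg_of_nonpos he hB.le),
      ← mul_assoc, ← Complex.ofReal_neg, ← Complex.ofReal_neg,
      ← Complex.ofReal_cpow (by linarith), ← mul_neg,
      ← Complex.ofReal_cpow (mul_nonneg he (by linarith)), Real.mul_rpow he (by linarith),
      Complex.ofReal_mul]

/-- From `(q/h)^α = 1 + O(h^p)` an `α`-th root gives `q/h = 1 + O(h^p)`, because `y^{1/α}` is
differentiable at `1`. The filter is arbitrary since `q ≥ 0` may be known only along a sequence of
steps. -/
lemma eq_betaCoeff_of_rpow_isBigO {α : ℝ} (hα : 0 < α) {p : ℕ} (hp : 1 ≤ p) {lam : ℝ}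
    {β : ℕ → ℝ} {l : Filter ℝ} [l.NeBot] (hl : l ≤ 𝓝[>] 0)
    (hq : ∀ᶠ h in l, 0 ≤ ∑ j ∈ Finset.range (p + 1), β j * Real.exp ((lam - j) * h))
    (hO : (fun h : ℝ => 1 - 1 / h ^ α *
      (∑ j ∈ Finset.range (p + 1), β j * Real.exp ((lam - j) * h)) ^ α) =O[l] fun h => h ^ p) :
    ∀ j ≤ p, β j = betaCoeff p lam j := by
  refine eq_betaCoeff_of_isBigO hp hl ?_
  set q := fun h : ℝ => ∑ j ∈ Finset.range (p + 1), β j * Real.exp ((lam - j) * h) with hqdef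
  have hl0 : l ≤ 𝓝 0 := hl.trans nhdsWithin_le_nhds
  have hpos : ∀ᶠ h : ℝ in l, 0 < h := hl self_mem_nhdsWithin
  have hy1 : Tendsto (fun h : ℝ => 1 / h ^ α * q h ^ α) l (𝓝 1) := by
    have h0 : Tendsto (fun h : ℝ => h ^ p) l (𝓝 0) := by
      have := ((continuous_pow (M := ℝ) p).tendsto 0).mono_left hl0
      simpa [show p ≠ 0 by omega] using this
    have := (hO.trans_tendsto h0).const_sub 1
    simpa using this
  have hd : (fun y : ℝ => y ^ (1 / α) - 1) =O[𝓝 1] fun y => y - 1 := by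
    have := (Real.hasDerivAt_rpow_const (x := 1) (p := 1 / α) (Or.inl one_ne_zero)).isBigO_sub
    simpa using this
  have h1 := (hd.comp_tendsto hy1).trans ((hO.neg_left).congr_left fun h => by
    simp only [Function.comp_def, hqdef]; ring)
  have h2 := h1.mul (isBigO_refl (fun h : ℝ => h) l)
  refine h2.congr' ?_ (Eventually.of_forall fun h => (pow_succ h p).symm)
  filter_upwards [hq, hpos] with h hqh hh
  have : (1 / h ^ α * q h ^ α) ^ (1 / α) = q h / h := by
    rw [one_div_mul_eq_div, ← Real.div_rpow hqh hh.le, one_div,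
      Real.rpow_rpow_inv (div_nonneg hqh hh.le) hα.ne']
  rw [Function.comp_def]
  simp only [this]
  rw [sub_mul, div_mul_cancel₀ _ hh.ne', one_mul]

lemma even_of_exp_eq_one {α : ℝ} (hα : 0 < α) (h : Complex.exp (Real.pi * Complex.I * α) = 1) :
    ∃ k : ℕ, α = 2 * k := by
  obtain ⟨n, hn⟩ := Complex.exp_eq_one_iff.1 h
  have h2 : (α : ℂ) = ((2 * n : ℝ) : ℂ) := by
    have hpi : (Real.pi : ℂ) ≠ 0 := by exact_mod_cast Real.pi_ne_zero
    have := Complex.I_ne_zero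
    have h3 : (Real.pi * Complex.I : ℂ) * α = Real.pi * Complex.I * (2 * n) := by rw [hn]; ring
    have := mul_left_cancel₀ (mul_ne_zero hpi this) h3
    rw [this]; push_cast; ring
  have h3 : α = 2 * n := by exact_mod_cast h2
  have hn0 : 0 ≤ n := by
    have : (0 : ℝ) < n := by linarith
    exact_mod_cast this.le
  lift n to ℕ using hn0
  exact ⟨n, by exact_mod_cast h3⟩

theorem eq_betaCoeff_of_approximatesLeft {α r : ℝ} (hα : 0 < α) {p N : ℕ} (hp : 1 ≤ p)
    {β w : ℕ → ℝ} (hw : IsPowerGenerating α p β w) (happ : ApproximatesLeft α r p N w) :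
    (∀ j ≤ p, β j = betaCoeff p (r / α) j) ∨
      ((∃ k : ℕ, α = 2 * k) ∧ ∀ j ≤ p, β j = -betaCoeff p (r / α) j) := by
  have h0 := happ truncExp (isSmoothIntegrable_truncExp N) 0
  rw [leftDeriv_truncExp α] at h0
  set q := fun h : ℝ => ∑ j ∈ Finset.range (p + 1), β j * Real.exp ((r / α - j) * h) with hq
  set y := fun h : ℝ => 1 / h ^ α * (Real.exp (r * h) * ∑' k : ℕ, w k * Real.exp (-h) ^ k) with hy
  have hO : (fun h : ℝ => 1 - y h) =O[𝓝[>] 0] fun h => h ^ p := by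
    refine h0.congr' ?_ EventuallyEq.rfl
    filter_upwards [leftDiff_truncExp α r w] with h hh
    rw [hh]
  have hpos : ∀ᶠ h : ℝ in 𝓝[>] 0, 0 < h := self_mem_nhdsWithin
  -- Either `q ≥ 0` for arbitrarily small steps, and restricting to these is enough, or `q < 0` for
  -- all small steps.
  by_cases hf : ∃ᶠ h in 𝓝[>] (0 : ℝ), 0 ≤ q h
  · left
    have hne : (𝓝[>] (0 : ℝ) ⊓ 𝓟 {h | 0 ≤ q h}).NeBot := frequently_mem_iff_neBot.1 hf
    have hev : ∀ᶠ h in 𝓝[>] (0 : ℝ) ⊓ 𝓟 {h | 0 ≤ q h}, 0 ≤ q h :=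
      mem_inf_of_right (mem_principal_self _)
    refine eq_betaCoeff_of_rpow_isBigO hα hp inf_le_left hev ?_
    refine (hO.mono inf_le_left).congr' ?_ EventuallyEq.rfl
    filter_upwards [hev, inf_le_left (b := 𝓟 {h | 0 ≤ q h}) hpos] with h hqh hh
    have := exp_mul_tsum_eq (r := r) hα hw hh
    rw [← Complex.ofReal_cpow hqh] at this
    simp only [hy, Complex.ofReal_injective this]
    rfl
  · right
    rw [not_frequently] at hf
    have hyq : ∀ᶠ h in 𝓝[>] (0 : ℝ),
        (y h : ℂ) = ((1 / h ^ α * (-q h) ^ α : ℝ) : ℂ) * Complex.exp (Real.pi * Complex.I * α) := by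
      filter_upwards [hf, hpos] with h hqh hh
      rw [not_le] at hqh
      have := exp_mul_tsum_eq (r := r) hα hw hh
      rw [Complex.ofReal_cpow_of_nonpos hqh.le, ← Complex.ofReal_neg,
        ← Complex.ofReal_cpow (by linarith)] at this
      simp only [hy]
      rw [Complex.ofReal_mul, this, Complex.ofReal_mul, ← mul_assoc]
    have hy1 : Tendsto y (𝓝[>] 0) (𝓝 1) := by
      have h0 : Tendsto (fun h : ℝ => h ^ p) (𝓝[>] 0) (𝓝 0) := by
        have := ((continuous_pow (M := ℝ) p).tendsto 0).mono_left (nhdsWithin_le_nhds (s := Set.Ioi 0))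
        simpa [show p ≠ 0 by omega] using this
      have := (hO.trans_tendsto h0).const_sub 1
      simpa using this
    have hnorm : ‖Complex.exp (Real.pi * Complex.I * α)‖ = 1 := by
      rw [show (Real.pi * Complex.I * α : ℂ) = ((Real.pi * α : ℝ) : ℂ) * Complex.I by
        push_cast; ring]
      exact Complex.norm_exp_ofReal_mul_I _
    have habs : ∀ᶠ h in 𝓝[>] (0 : ℝ), |y h| = 1 / h ^ α * (-q h) ^ α := by
      filter_upwards [hyq, hf, hpos] with h hyh hqh hh
      have := congrArg norm hyh
      rw [norm_mul, hnorm, mul_one, Complex.norm_real, Complex.norm_real, Real.norm_eq_abs,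
        Real.norm_eq_abs] at this
      rw [this, abs_of_nonneg]
      have : 0 ≤ (-q h) ^ α := Real.rpow_nonneg (by linarith) _
      positivity
    -- `y` is `|y|` times this unimodular constant, and both `y` and `|y|` tend to `1`.
    have hexp : Complex.exp (Real.pi * Complex.I * α) = 1 := by
      have t1 : Tendsto (fun h => (y h : ℂ)) (𝓝[>] 0) (𝓝 1) := by
        have := (Complex.continuous_ofReal.tendsto 1).comp hy1
        simpa [Function.comp_def] using this
      have t2 : Tendsto (fun h => ((|y h| : ℝ) : ℂ) * Complex.exp (Real.pi * Complex.I * α))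
          (𝓝[>] 0) (𝓝 (Complex.exp (Real.pi * Complex.I * α))) := by
        have := ((Complex.continuous_ofReal.tendsto |1|).comp hy1.abs).mul_const
          (Complex.exp (Real.pi * Complex.I * α))
        simpa [Function.comp_def] using this
      refine tendsto_nhds_unique (t2.congr' ?_) t1
      filter_upwards [hyq, habs] with h h1 h2
      rw [h1, h2]
    refine ⟨even_of_exp_eq_one hα hexp, fun j hj => ?_⟩
    have hneg : ∀ h : ℝ, ∑ j ∈ Finset.range (p + 1), -β j * Real.exp ((r / α - j) * h) = -q h := by
      intro h; simp [hq]
    have := eq_betaCoeff_of_rpow_isBigO (β := fun j => -β j) (lam := r / α) hα hp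
      (l := 𝓝[>] 0) le_rfl (by
        filter_upwards [hf] with h hqh
        rw [hneg]; linarith) (by
        refine hO.congr' ?_ EventuallyEq.rfl
        filter_upwards [hyq] with h h1
        rw [hexp, mul_one] at h1
        rw [hneg, Complex.ofReal_injective h1]) j hj
    linarith

/-! ### Change of sign for even exponents, and reflection between left and right. -/

lemma IsPowerGenerating.neg {α : ℝ} (hα : ∃ k : ℕ, α = 2 * k) {p : ℕ} {β w : ℕ → ℝ}
    (hw : IsPowerGenerating α p β w) : IsPowerGenerating α p (fun j => -β j) w := by
  obtain ⟨k, rfl⟩ := hα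
  intro x h0 h1
  have h : basePoly p (fun j => -β j) (x : ℂ) = -basePoly p β x := by simp [basePoly]
  have hc : ((2 * k : ℝ) : ℂ) = ((2 * k : ℕ) : ℂ) := by push_cast; rfl
  have := hw x h0 h1
  rw [hc, Complex.cpow_natCast] at this
  rwa [h, hc, Complex.cpow_natCast, (even_two_mul k).neg_pow]

/-- Differentiating `ν` times after `y ↦ -y` produces the factor `(-1)^ν` of the right derivative.
-/
lemma leftDeriv_comp_neg (α : ℝ) (f : ℝ → ℝ) (x : ℝ) :
    leftDeriv α (fun t => f (-t)) (-x) = rightDeriv α f x := by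
  have h1 : ∀ y : ℝ, ∫ t in Set.Iio y, f (-t) / (y - t) ^ (α + 1 - ((⌊α⌋₊ + 1 : ℕ) : ℝ))
      = ∫ t in Set.Ioi (-y), f t / (t - -y) ^ (α + 1 - ((⌊α⌋₊ + 1 : ℕ) : ℝ)) := by
    intro y
    rw [← integral_comp_neg_Iic, integral_Iic_eq_integral_Iio]
    refine setIntegral_congr_fun measurableSet_Iio fun t _ => ?_
    ring_nf
  unfold leftDeriv rightDeriv
  simp_rw [h1]
  rw [iteratedDeriv_comp_neg (⌊α⌋₊ + 1) (fun z => ∫ t in Set.Ioi z,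
    f t / (t - z) ^ (α + 1 - ((⌊α⌋₊ + 1 : ℕ) : ℝ))), neg_neg, smul_eq_mul]
  ring

lemma leftDiff_comp_neg (α r : ℝ) (w : ℕ → ℝ) (h : ℝ) (f : ℝ → ℝ) (x : ℝ) :
    leftDiff α r w h (fun t => f (-t)) (-x) = rightDiff α r w h f x := by
  unfold leftDiff rightDiff
  congr 1
  refine tsum_congr fun k => ?_
  ring_nf

lemma IsSmoothIntegrable.comp_neg {N : ℕ} {f : ℝ → ℝ} (hf : IsSmoothIntegrable N f) :
    IsSmoothIntegrable N fun t => f (-t) := by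
  refine ⟨hf.1.comp contDiff_neg, fun k hk => ?_⟩
  have : iteratedDeriv k (fun t => f (-t)) = fun t => (-1 : ℝ) ^ k • iteratedDeriv k f (-t) :=
    funext fun t => iteratedDeriv_comp_neg k f t
  rw [this]
  exact ((hf.2 k hk).comp_neg).smul ((-1 : ℝ) ^ k)

lemma approximatesRight_iff_approximatesLeft {α r : ℝ} {p N : ℕ} {w : ℕ → ℝ} :
    ApproximatesRight α r p N w ↔ ApproximatesLeft α r p N w := by
  constructor
  · intro h f hf x
    have := h _ hf.comp_neg (-x)
    simpa only [← leftDeriv_comp_neg, ← leftDiff_comp_neg, neg_neg] using this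
  · intro h f hf x
    have := h _ hf.comp_neg (-x)
    simpa only [leftDeriv_comp_neg, leftDiff_comp_neg] using this

/-! ### Sufficiency for integer order. -/

/-- Continuity of the sum at `0` kills the constant term; dividing by `x > 0` shifts the sequence.
The identity is asked only for `x > 0` so that this division preserves it. -/
lemma eq_zero_of_tsum_mul_pow_eq_zero {d : ℕ → ℝ} (hd : Summable fun k => |d k|)
    (h : ∀ x : ℝ, 0 < x → x < 1 → ∑' k, d k * x ^ k = 0) (k : ℕ) : d k = 0 := by
  have hcont : ∀ d : ℕ → ℝ, (Summable fun k => |d k|) →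
      (∀ x : ℝ, 0 < x → x < 1 → ∑' k, d k * x ^ k = 0) → d 0 = 0 := by
    intro d hd h
    have hc : ContinuousOn (fun x : ℝ => ∑' k, d k * x ^ k) (Set.Icc 0 1) := by
      refine continuousOn_tsum (fun k => by fun_prop) hd fun k x hx => ?_
      rw [norm_mul, norm_pow, Real.norm_eq_abs, Real.norm_eq_abs, abs_of_nonneg hx.1]
      exact mul_le_of_le_one_right (abs_nonneg _) (pow_le_one₀ hx.1 hx.2)
    have h1 := (hc 0 ⟨le_rfl, zero_le_one⟩).tendsto.mono_left
      (nhdsWithin_mono _ (Set.Ioo_subset_Icc_self (a := (0 : ℝ)) (b := 1)))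
    rw [nhdsWithin_Ioo_eq_nhdsGT one_pos] at h1
    have h2 : ∑' k, d k * (0 : ℝ) ^ k = d 0 := by
      rw [tsum_eq_single 0 (fun k hk => by simp [hk])]; simp
    rw [h2] at h1
    refine tendsto_nhds_unique (h1.congr' ?_) tendsto_const_nhds
    filter_upwards [Ioo_mem_nhdsGT one_pos] with x hx using h x hx.1 hx.2
  induction k generalizing d with
  | zero => exact hcont d hd h
  | succ k ih =>
    refine ih (d := fun k => d (k + 1)) ((summable_nat_add_iff 1).2 hd) fun x h0 h1 => ?_
    have hs : Summable fun k => d k * x ^ k := by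
      refine hd.of_norm_bounded fun k => ?_
      rw [norm_mul, norm_pow, Real.norm_eq_abs, Real.norm_eq_abs, abs_of_nonneg h0.le]
      exact mul_le_of_le_one_right (abs_nonneg _) (pow_le_one₀ h0.le h1.le)
    have := hs.tsum_eq_zero_add
    rw [h x h0 h1, hcont d hd h, zero_mul, zero_add] at this
    have h2 : ∑' k, d (k + 1) * x ^ (k + 1) = x * ∑' k, d (k + 1) * x ^ k := by
      rw [← tsum_mul_left]; exact tsum_congr fun k => by ring
    rw [h2] at this
    exact (mul_eq_zero.1 this.symm).resolve_left h0.ne'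

/-- For a natural exponent the generating function is a polynomial. -/
lemma IsPowerGenerating.exists_polynomial {n p : ℕ} {β w : ℕ → ℝ}
    (hw : IsPowerGenerating n p β w) (hs : Summable fun k => |w k|) :
    ∃ Q : Polynomial ℝ, w = Q.coeff ∧
      ∀ x : ℝ, Q.eval x = (∑ j ∈ Finset.range (p + 1), β j * x ^ j) ^ n := by
  set Q : Polynomial ℝ :=
    (∑ j ∈ Finset.range (p + 1), Polynomial.C (β j) * Polynomial.X ^ j) ^ n with hQ
  have he : ∀ x : ℝ, Q.eval x = (∑ j ∈ Finset.range (p + 1), β j * x ^ j) ^ n := fun x => by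
    simp [hQ, Polynomial.eval_finsetSum]
  refine ⟨Q, ?_, he⟩
  have hQs : ∀ x : ℝ, HasSum (fun k => Q.coeff k * x ^ k) (Q.eval x) := fun x => by
    rw [Polynomial.eval_eq_sum_range]
    refine hasSum_sum_of_ne_finset_zero fun k hk => ?_
    rw [Polynomial.coeff_eq_zero_of_natDegree_lt (by simpa using hk), zero_mul]
  have hQa : Summable fun k => |Q.coeff k| := by
    refine summable_of_ne_finset_zero (s := Finset.range (Q.natDegree + 1)) fun k hk => ?_
    rw [Polynomial.coeff_eq_zero_of_natDegree_lt (by simpa using hk), abs_zero]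
  funext k
  refine sub_eq_zero.1 (eq_zero_of_tsum_mul_pow_eq_zero (d := fun k => w k - Q.coeff k) ?_ ?_ k)
  · exact summable_abs_iff.2 ((summable_abs_iff.1 hs).sub (summable_abs_iff.1 hQa))
  · intro x h0 h1
    have h2 := hw x h0.le h1
    rw [basePoly_ofReal, Complex.ofReal_natCast, Complex.cpow_natCast, ← Complex.ofReal_pow,
      ← he] at h2
    have h3 : HasSum (fun k => w k * x ^ k) (Q.eval x) := by
      rw [← Complex.hasSum_ofReal]
      simpa using h2
    have := (h3.sub (hQs x)).tsum_eq
    simpa [sub_mul] using this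

/-- The kernel exponent is `0`, so the integral is a primitive of `f`, and one of the `⌊n⌋ + 1 = n +
1` derivatives undoes it. -/
lemma leftDeriv_natCast (n : ℕ) {f : ℝ → ℝ} (hf : Continuous f) (hi : Integrable f) (x : ℝ) :
    leftDeriv n f x = iteratedDeriv n f x := by
  have hJ : (fun y => ∫ t in Set.Iio y, f t / (y - t) ^ ((n : ℝ) + 1 - ((n + 1 : ℕ) : ℝ)))
      = fun y => (∫ t in Set.Iic (0 : ℝ), f t) + ∫ t in (0 : ℝ)..y, f t := by
    funext y
    rw [show (n : ℝ) + 1 - ((n + 1 : ℕ) : ℝ) = 0 by push_cast; ring,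
      ← intervalIntegral.integral_Iic_sub_Iic hi.integrableOn hi.integrableOn,
      integral_Iic_eq_integral_Iio (x := y)]
    simp
  have hd : deriv (fun y => (∫ t in Set.Iic (0 : ℝ), f t) + ∫ t in (0 : ℝ)..y, f t) = f := by
    funext y
    rw [deriv_const_add, hf.deriv_integral]
  unfold leftDeriv
  rw [Nat.floor_natCast, hJ, iteratedDeriv_succ', hd]
  simp

lemma taylor_isBigO {N : ℕ} {f : ℝ → ℝ} (hf : ContDiff ℝ N f) (x : ℝ) :
    (fun t : ℝ => f (x + t) - ∑ i ∈ Finset.range N, iteratedDeriv i f x / i.factorial * t ^ i)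
      =O[𝓝 0] fun t => t ^ N := by
  have ht : Tendsto (fun t : ℝ => x + t) (𝓝 0) (𝓝 x) := by
    have : Continuous fun t : ℝ => x + t := by fun_prop
    simpa using this.tendsto 0
  have h1 := ((taylor_isLittleO_univ (x₀ := x) hf).comp_tendsto ht).isBigO
  have h2 : (fun t : ℝ => iteratedDeriv N f x / N.factorial * t ^ N) =O[𝓝 0] fun t => t ^ N :=
    (isBigO_refl _ _).const_mul_left _
  simp only [Function.comp_def, add_sub_cancel_left, taylor_within_apply, iteratedDerivWithin_univ,
    Finset.sum_range_succ] at h1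
  refine (h1.add h2).congr_left fun t => ?_
  rw [← sub_sub, smul_eq_mul, div_eq_inv_mul, mul_right_comm, sub_add_cancel]
  congr 1
  refine Finset.sum_congr rfl fun i _ => ?_
  rw [smul_eq_mul]; ring

/-- Induction on `G^{n+1} - h^{n+1} = G^n (G - h) + h (G^n - h^n)`. -/
lemma pow_sub_pow_isBigO {G : ℝ → ℝ} {p : ℕ}
    (hG : (fun h => G h - h) =O[𝓝 0] fun h => h ^ (p + 1)) (n : ℕ) :
    (fun h => G h ^ n - h ^ n) =O[𝓝 0] fun h => h ^ (n + p) := by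
  have hG1 : G =O[𝓝 0] fun h => h := by
    have : (fun h : ℝ => h ^ (p + 1)) =O[𝓝 0] fun h => h := by
      simpa using (isBigO_refl (fun h : ℝ => h) (𝓝 0)).mul ((continuous_pow (M := ℝ) p).tendsto 0
        |>.isBigO_one ℝ) |>.congr_left fun h => (pow_succ' h p).symm
    simpa using (hG.trans this).add (isBigO_refl (fun h : ℝ => h) _)
  induction n with
  | zero => simpa using isBigO_zero _ _
  | succ n ih =>
    have h1 := ((hG1.pow n).mul hG).congr_right (g₂ := fun h : ℝ => h ^ (n + 1 + p))
      fun h => by ring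
    have h2 := ((isBigO_refl (fun h : ℝ => h) (𝓝 0)).mul ih).congr_right
      (g₂ := fun h : ℝ => h ^ (n + 1 + p)) fun h => by ring
    exact (h1.add h2).congr_left fun h => by ring

theorem approximatesLeft_natCast {n : ℕ} (hn : 0 < n) {r : ℝ} {p N : ℕ} (hp : 1 ≤ p)
    (hN : n + p ≤ N) {w : ℕ → ℝ} (hs : Summable fun k => |w k|)
    (hw : IsPowerGenerating n p (betaCoeff p (r / n)) w) : ApproximatesLeft n r p N w := by
  obtain ⟨Q, rfl, hQ⟩ := hw.exists_polynomial hs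
  intro f hf x
  set K := Q.natDegree + 1
  -- The finite sum `∑ w_k e^{(r-k)h}` equals `q(h)^n = h^n + O(h^{n+p})`; comparison of Taylor
  -- coefficients gives the moments of the weights.
  have hmom : ∀ i < n + p, (∑ k ∈ Finset.range K, Q.coeff k * (r - k) ^ i) / i.factorial
      = if i = n then 1 else 0 := by
    have h1 := sum_mul_exp_sub_isBigO (Finset.range K) Q.coeff (fun k => r - k) (n + p)
    have h2 := pow_sub_pow_isBigO (sum_betaCoeff_mul_exp_sub_isBigO hp (r / n)) n
    have hexp : ∀ h : ℝ, ∑ k ∈ Finset.range K, Q.coeff k * Real.exp ((r - k) * h) =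
        (∑ j ∈ Finset.range (p + 1), betaCoeff p (r / n) j * Real.exp ((r / n - j) * h)) ^ n := by
      intro h
      have e1 : ∑ k ∈ Finset.range K, Q.coeff k * Real.exp ((r - k) * h) =
          Real.exp (r * h) * Q.eval (Real.exp (-h)) := by
        rw [Polynomial.eval_eq_sum_range, Finset.mul_sum]
        refine Finset.sum_congr rfl fun k _ => ?_
        rw [← Real.exp_nat_mul, mul_left_comm, ← Real.exp_add]
        congr 2; ring
      have e2 : ∑ j ∈ Finset.range (p + 1), betaCoeff p (r / n) j * Real.exp ((r / n - j) * h) =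
          Real.exp (r / n * h) *
            ∑ j ∈ Finset.range (p + 1), betaCoeff p (r / n) j * Real.exp (-h) ^ j := by
        rw [Finset.mul_sum]
        refine Finset.sum_congr rfl fun k _ => ?_
        rw [← Real.exp_nat_mul, mul_left_comm, ← Real.exp_add]
        congr 2; ring
      rw [e1, e2, hQ, mul_pow, ← Real.exp_nat_mul]
      congr 2
      field_simp
    intro i hi
    refine sub_eq_zero.1 (eq_zero_of_sum_isBigO_pow (l := 𝓝[>] 0) le_rfl (n + p)
      (fun i => (∑ k ∈ Finset.range K, Q.coeff k * (r - k) ^ i) / i.factorial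
        - if i = n then 1 else 0) ?_ i hi)
    refine ((h2.sub h1).mono nhdsWithin_le_nhds).congr_left fun h => ?_
    have : ∑ i ∈ Finset.range (n + p), (if i = n then (1 : ℝ) else 0) * h ^ i = h ^ n := by
      rw [Finset.sum_eq_single n]
      · simp
      · intro i _ hi; simp [hi]
      · intro hi; simp at hi; omega
    rw [hexp]
    simp only [sub_mul _ _ (h ^ _), Finset.sum_sub_distrib, this]
    ring
  have hT : (fun h : ℝ => ∑ k ∈ Finset.range K, Q.coeff k * f (x - (k - r) * h)
      - iteratedDeriv n f x * h ^ n) =O[𝓝 0] fun h => h ^ (n + p) := by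
    have h1 : ∀ k ∈ Finset.range K, (fun h : ℝ => Q.coeff k * (f (x + (r - k) * h) -
        ∑ i ∈ Finset.range (n + p), iteratedDeriv i f x / i.factorial * ((r - k) * h) ^ i))
        =O[𝓝 0] fun h => h ^ (n + p) := by
      intro k _
      have ht : Tendsto (fun h : ℝ => (r - k) * h) (𝓝 0) (𝓝 0) := by
        have : Continuous (fun h : ℝ => (r - k) * h) := by fun_prop
        simpa using this.tendsto 0
      have h1 := (taylor_isBigO (hf.1.of_le (by exact_mod_cast hN)) x).comp_tendsto ht
      refine (h1.trans ?_).const_mul_left _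
      simp only [Function.comp_def, mul_pow]
      exact (isBigO_refl _ _).const_mul_left _
    refine (IsBigO.fun_sum h1).congr_left fun h => ?_
    simp only [mul_sub, Finset.sum_sub_distrib, Finset.mul_sum]
    rw [Finset.sum_comm (s := Finset.range K)]
    congr 1
    · refine Finset.sum_congr rfl fun k _ => ?_
      congr 2; ring
    · have : ∀ i ∈ Finset.range (n + p), ∑ k ∈ Finset.range K,
          Q.coeff k * (iteratedDeriv i f x / i.factorial * ((r - k) * h) ^ i) =
          iteratedDeriv i f x * (if i = n then 1 else 0) * h ^ i := by
        intro i hi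
        rw [← hmom i (by simpa using hi), Finset.sum_div, Finset.mul_sum, Finset.sum_mul]
        refine Finset.sum_congr rfl fun k _ => ?_
        rw [mul_pow]; ring
      rw [Finset.sum_congr rfl this, Finset.sum_eq_single n]
      · simp
      · intro i _ hi; simp [hi]
      · intro hi; simp at hi; omega
  have hinv := (isBigO_refl (fun h : ℝ => (h ^ n)⁻¹) (𝓝[>] 0)).mul
    ((hT.neg_left).mono nhdsWithin_le_nhds)
  refine hinv.congr' ?_ ?_
  · filter_upwards [self_mem_nhdsWithin] with h hh
    have hh : h ≠ 0 := (Set.mem_Ioi.1 hh).ne'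
    rw [leftDeriv_natCast n hf.1.continuous (by simpa using hf.2 0 (Nat.zero_le _))]
    unfold leftDiff
    rw [tsum_eq_sum (s := Finset.range K) fun k hk => by
      rw [Polynomial.coeff_eq_zero_of_natDegree_lt (by simpa [K] using hk), zero_mul],
      Real.rpow_natCast]
    rw [neg_sub, mul_sub, one_div, mul_left_comm, inv_mul_cancel₀ (pow_ne_zero n hh), mul_one]
  · filter_upwards [self_mem_nhdsWithin] with h hh
    have hh : h ≠ 0 := (Set.mem_Ioi.1 hh).ne'
    rw [pow_add]
    field_simp

/-! ### Sufficiency for non-integer order: the symbol on the imaginary axis. -/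

lemma norm_exp_neg_pow_le {s : ℂ} (hs : 0 ≤ s.re) (k : ℕ) : ‖Complex.exp (-s) ^ k‖ ≤ 1 := by
  rw [norm_pow, Complex.norm_exp]
  exact pow_le_one₀ (Real.exp_pos _).le (Real.exp_le_one_iff.2 (by simpa using hs))

lemma norm_mul_exp_neg_pow_le (w : ℕ → ℝ) {s : ℂ} (hs : 0 ≤ s.re) (k : ℕ) :
    ‖(w k : ℂ) * Complex.exp (-s) ^ k‖ ≤ |w k| := by
  rw [norm_mul, Complex.norm_real, Real.norm_eq_abs]
  exact mul_le_of_le_one_right (abs_nonneg _) (norm_exp_neg_pow_le hs k)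

/-- Weierstrass M-test with `|e^{-s}| ≤ 1`: continuity reaches the imaginary axis, where the Fourier
symbol lives, while holomorphy is available only inside. -/
lemma continuousOn_tsum_mul_exp_neg_pow {w : ℕ → ℝ} (hs : Summable fun k => |w k|) :
    ContinuousOn (fun s : ℂ => ∑' k, (w k : ℂ) * Complex.exp (-s) ^ k) {s | 0 ≤ s.re} :=
  continuousOn_tsum (fun k => by fun_prop) hs fun k _ hx => norm_mul_exp_neg_pow_le w hx k

lemma differentiableOn_tsum_mul_exp_neg_pow {w : ℕ → ℝ} (hs : Summable fun k => |w k|) :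
    DifferentiableOn ℂ (fun s : ℂ => ∑' k, (w k : ℂ) * Complex.exp (-s) ^ k) {s | 0 < s.re} :=
  Complex.differentiableOn_tsum_of_summable_norm hs (fun k => by fun_prop)
    (isOpen_lt continuous_const Complex.continuous_re)
    fun k _ hx => norm_mul_exp_neg_pow_le w (le_of_lt hx) k

/-- The exponential sum attached to the coefficients `betaCoeff`. -/
noncomputable def expSum (p : ℕ) (lam : ℝ) (s : ℂ) : ℂ :=
  ∑ j ∈ Finset.range (p + 1), (betaCoeff p lam j : ℂ) * Complex.exp (((lam - j : ℝ) : ℂ) * s)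

lemma differentiable_expSum (p : ℕ) (lam : ℝ) : Differentiable ℂ (expSum p lam) := by
  unfold expSum
  fun_prop

lemma expSum_div_sub_one_isBigO {p : ℕ} (hp : 1 ≤ p) (lam : ℝ) :
    (fun s : ℂ => expSum p lam s / s - 1) =O[𝓝[≠] 0] fun s => s ^ p := by
  have h := ((isBigO_refl (fun s : ℂ => s⁻¹) (𝓝[≠] 0)).mul
    ((sum_betaCoeff_mul_cexp_sub_isBigO hp lam).mono nhdsWithin_le_nhds))
  refine h.congr' ?_ ?_
  · filter_upwards [self_mem_nhdsWithin] with s hs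
    have : s ≠ 0 := hs
    rw [mul_sub, inv_mul_cancel₀ this, div_eq_inv_mul, expSum]
  · filter_upwards [self_mem_nhdsWithin] with s hs
    have : s ≠ 0 := hs
    rw [pow_succ']
    field_simp

/-- The first bound keeps the quotient in a disc inside the slit plane, so its power is holomorphic;
the second uses differentiability of `u^α` at `1`. -/
lemma exists_expSum_bound {p : ℕ} (hp : 1 ≤ p) (α lam : ℝ) :
    ∃ δ > 0, ∃ C, ∀ s : ℂ, s ≠ 0 → ‖s‖ < δ → ‖expSum p lam s / s - 1‖ < 1 ∧
      ‖(expSum p lam s / s) ^ (α : ℂ) - 1‖ ≤ C * ‖s‖ ^ p := by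
  have h1 := expSum_div_sub_one_isBigO hp lam
  have h0 : Tendsto (fun s : ℂ => s ^ p) (𝓝[≠] 0) (𝓝 0) := by
    have := ((continuous_pow (M := ℂ) p).tendsto 0).mono_left (nhdsWithin_le_nhds (s := {0}ᶜ))
    simpa [show p ≠ 0 by omega] using this
  have ht0 := h1.trans_tendsto h0
  have ht : Tendsto (fun s : ℂ => expSum p lam s / s) (𝓝[≠] 0) (𝓝 1) := by
    simpa using ht0.add_const 1
  have hd : (fun u : ℂ => u ^ (α : ℂ) - 1) =O[𝓝 1] fun u => u - 1 := by
    have := ((hasDerivAt_id (1 : ℂ)).cpow_const (c := α) (by simp)).isBigO_sub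
    simpa using this
  obtain ⟨C, hC⟩ := ((hd.comp_tendsto ht).trans h1).bound
  have hev := hC.and (ht0.norm.eventually_lt_const (u := 1) (by simp))
  rw [eventually_nhdsWithin_iff, Metric.eventually_nhds_iff] at hev
  obtain ⟨δ, hδ, H⟩ := hev
  refine ⟨δ, hδ, C, fun s hs hsδ => ?_⟩
  have := H (by simpa using hsδ) hs
  exact ⟨this.2, by simpa using this.1⟩

lemma mem_slitPlane_of_norm_sub_one_lt {u : ℂ} (h : ‖u - 1‖ < 1) : u ∈ Complex.slitPlane :=
  Complex.ball_one_subset_slitPlane (by simpa [dist_eq_norm] using h)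

/-- Near the origin of the closed right half plane, the normalized generating function is the
power of `s` times the power of a function close to `1`. -/
lemma exp_mul_tsum_eq_cpow_mul_cpow {α r : ℝ} (hα : 0 < α) {p : ℕ}
    {w : ℕ → ℝ} (hs : Summable fun k => |w k|)
    (hw : IsPowerGenerating α p (betaCoeff p (r / α)) w) {δ : ℝ} (hδ : 0 < δ)
    (hb : ∀ s : ℂ, s ≠ 0 → ‖s‖ < δ → ‖expSum p (r / α) s / s - 1‖ < 1) {θ : ℝ} (hθ : θ ≠ 0)
    (hθδ : |θ| < δ) :
    Complex.exp (r * (θ * Complex.I)) * ∑' k, (w k : ℂ) * Complex.exp (-(θ * Complex.I)) ^ k =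
      (θ * Complex.I) ^ (α : ℂ) *
        (expSum p (r / α) (θ * Complex.I) / (θ * Complex.I)) ^ (α : ℂ) := by
  set F₁ := fun s : ℂ => Complex.exp (r * s) * ∑' k, (w k : ℂ) * Complex.exp (-s) ^ k with hF₁
  set F₂ := fun s : ℂ => s ^ (α : ℂ) * (expSum p (r / α) s / s) ^ (α : ℂ) with hF₂
  set U : Set ℂ := {s | 0 < s.re} ∩ Metric.ball 0 δ with hU
  have hUo : IsOpen U := (isOpen_lt continuous_const Complex.continuous_re).inter Metric.isOpen_ball
  have hF₂d : ∀ s : ℂ, s ∈ Complex.slitPlane → ‖s‖ < δ → DifferentiableAt ℂ F₂ s := by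
    intro s hs hsδ
    have hne : s ≠ 0 := Complex.slitPlane_ne_zero hs
    have h1 : DifferentiableAt ℂ (fun s => expSum p (r / α) s / s) s :=
      (differentiable_expSum p _ s).div differentiableAt_id hne
    exact (differentiableAt_id.cpow_const hs).mul
      (h1.cpow_const (mem_slitPlane_of_norm_sub_one_lt (hb s hne hsδ)))
  have hEq : Set.EqOn F₁ F₂ U := by
    have a1 : AnalyticOnNhd ℂ F₁ U := by
      refine DifferentiableOn.analyticOnNhd ?_ hUo
      exact DifferentiableOn.mul (by fun_prop)
        ((differentiableOn_tsum_mul_exp_neg_pow hs).mono Set.inter_subset_left)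
    have a2 : AnalyticOnNhd ℂ F₂ U := by
      refine DifferentiableOn.analyticOnNhd (fun s hs => ?_) hUo
      exact (hF₂d s (Or.inl hs.1) (by simpa using hs.2)).differentiableWithinAt
    have hc : IsPreconnected U :=
      ((convex_halfSpace_re_gt 0).inter (convex_ball 0 δ)).isPreconnected
    -- Identity theorem on a half disc: on the real segment `(0, δ)` the quotient is positive, so
    -- the principal powers there are real powers.
    refine a1.eqOn_of_preconnected_of_frequently_eq a2 hc (z₀ := ((δ / 2 : ℝ) : ℂ)) ?_ ?_
    · refine ⟨by simpa using hδ, ?_⟩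
      rw [mem_ball_zero_iff, Complex.norm_real, Real.norm_eq_abs, abs_of_pos (by positivity)]
      linarith
    · have ht : Tendsto (fun x : ℝ => (x : ℂ)) (𝓝[≠] (δ / 2)) (𝓝[≠] ((δ / 2 : ℝ) : ℂ)) := by
        refine (Complex.continuous_ofReal.continuousWithinAt).tendsto_nhdsWithin fun x hx => ?_
        simpa only [Set.mem_compl_iff, Set.mem_singleton_iff, Complex.ofReal_inj] using hx
      refine ht.frequently (Eventually.frequently ?_)
      have hnhds : Set.Ioo 0 δ ∈ 𝓝[≠] (δ / 2) :=
        mem_nhdsWithin_of_mem_nhds (Ioo_mem_nhds (by linarith) (by linarith))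
      filter_upwards [hnhds] with x hx
      have e1 := exp_mul_tsum_eq (r := r) hα hw hx.1
      set q := ∑ j ∈ Finset.range (p + 1), betaCoeff p (r / α) j * Real.exp ((r / α - j) * x)
      have e2 : expSum p (r / α) x = (q : ℂ) := by
        simp [expSum, q]
      have hx0 : (x : ℂ) ≠ 0 := by exact_mod_cast hx.1.ne'
      have hb1 := hb x hx0 (by
        rw [Complex.norm_real, Real.norm_eq_abs, abs_of_pos hx.1]; exact hx.2)
      rw [e2, ← Complex.ofReal_div, ← Complex.ofReal_one, ← Complex.ofReal_sub, Complex.norm_real,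
        Real.norm_eq_abs, abs_lt] at hb1
      have hqx : 0 < q / x := by linarith [hb1.1]
      have hq : 0 < q := by
        have := mul_pos hqx hx.1
        rwa [div_mul_cancel₀ _ hx.1.ne'] at this
      simp only [hF₁, hF₂]
      rw [e2, ← Complex.ofReal_div, ← Complex.ofReal_cpow hx.1.le, ← Complex.ofReal_cpow hqx.le,
        ← Complex.ofReal_mul (x ^ α), ← Real.mul_rpow hx.1.le hqx.le, mul_div_cancel₀ _ hx.1.ne',
        Complex.ofReal_cpow hq.le, ← e1]
      push_cast
      rfl
  -- For `θ ≠ 0` the point `iθ` avoids the cut, so both sides extend continuously along `ε + iθ`, `ε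
  -- → 0+`.
  have hθs : (θ * Complex.I : ℂ) ∈ Complex.slitPlane := Or.inr (by simpa using hθ)
  have hpath : Tendsto (fun ε : ℝ => (ε : ℂ) + θ * Complex.I) (𝓝[>] 0) (𝓝 (θ * Complex.I)) := by
    have : Continuous fun ε : ℝ => (ε : ℂ) + θ * Complex.I := by fun_prop
    have := (this.tendsto 0).mono_left (nhdsWithin_le_nhds (s := Set.Ioi 0))
    simpa using this
  have hnorm : ‖(θ * Complex.I : ℂ)‖ < δ := by simpa using hθδ
  have t2 := (hF₂d _ hθs hnorm).continuousAt.tendsto.comp hpath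
  have hF₁c : ContinuousOn F₁ {s | 0 ≤ s.re} :=
    ContinuousOn.mul (by fun_prop) (continuousOn_tsum_mul_exp_neg_pow hs)
  have hpath' : Tendsto (fun ε : ℝ => (ε : ℂ) + θ * Complex.I) (𝓝[>] 0)
      (𝓝[{s | 0 ≤ s.re}] (θ * Complex.I)) := by
    refine tendsto_nhdsWithin_iff.2 ⟨hpath, ?_⟩
    filter_upwards [self_mem_nhdsWithin] with ε hε
    simpa using (Set.mem_Ioi.1 hε).le
  have t1 := (hF₁c (θ * Complex.I) (by simp)).tendsto.comp hpath'
  refine tendsto_nhds_unique t1 (t2.congr' ?_)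
  have hev : ∀ᶠ ε : ℝ in 𝓝[>] 0, ‖(ε : ℂ) + θ * Complex.I‖ < δ :=
    hpath.norm.eventually_lt_const hnorm
  filter_upwards [hev, self_mem_nhdsWithin] with ε h1 h2
  exact (hEq ⟨by simpa using h2, by simpa using h1⟩).symm

/-- The symbol of the difference operator agrees with the symbol of the fractional derivative
up to an error of order `α + p`. -/
theorem exists_symbol_bound {α r : ℝ} (hα : 0 < α) {p : ℕ} (hp : 1 ≤ p)
    {w : ℕ → ℝ} (hs : Summable fun k => |w k|)
    (hw : IsPowerGenerating α p (betaCoeff p (r / α)) w) :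
    ∃ C, ∀ θ : ℝ, θ ≠ 0 → ‖(θ * Complex.I) ^ (α : ℂ) - Complex.exp (r * (θ * Complex.I)) *
      ∑' k, (w k : ℂ) * Complex.exp (-(θ * Complex.I)) ^ k‖ ≤ C * |θ| ^ (α + p) := by
  obtain ⟨δ, hδ, C, hC⟩ := exists_expSum_bound hp α (r / α)
  set A := ∑' k, |w k|
  have hA : 0 ≤ A := tsum_nonneg fun k => abs_nonneg _
  -- `C` serves `|θ| < δ`. For `|θ| ≥ δ` the error is at most `|θ|^α + A`, and powers of `|θ|/δ ≥ 1`
  -- raise both terms to order `α + p`.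
  refine ⟨max C (1 / δ ^ p + A / δ ^ (α + p)), fun θ hθ => ?_⟩
  have hθ0 : 0 < |θ| := abs_pos.2 hθ
  have hI : ‖(θ * Complex.I : ℂ)‖ = |θ| := by simp
  have hIne : (θ * Complex.I : ℂ) ≠ 0 := by simpa using hθ
  have hpow : ‖(θ * Complex.I : ℂ) ^ (α : ℂ)‖ = |θ| ^ α := by
    rw [Complex.norm_cpow_real, hI]
  have hadd : |θ| ^ (α + p) = |θ| ^ α * |θ| ^ p := by
    rw [Real.rpow_add hθ0, Real.rpow_natCast]
  rcases lt_or_ge |θ| δ with hlt | hge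
  · rw [exp_mul_tsum_eq_cpow_mul_cpow hα hs hw hδ (fun s h1 h2 => (hC s h1 h2).1) hθ hlt]
    have h1 := (hC _ hIne (by rwa [hI])).2
    rw [hI] at h1
    calc _ = ‖(θ * Complex.I : ℂ) ^ (α : ℂ)‖ *
          ‖(expSum p (r / α) (θ * Complex.I) / (θ * Complex.I)) ^ (α : ℂ) - 1‖ := by
          rw [← norm_mul, mul_sub, mul_one, norm_sub_rev]
      _ ≤ |θ| ^ α * (C * |θ| ^ p) := by
          rw [hpow]; gcongr
      _ = C * |θ| ^ (α + p) := by rw [hadd]; ring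
      _ ≤ _ := by gcongr; exact le_max_left _ _
  · have h1 : ‖Complex.exp (r * (θ * Complex.I)) *
        ∑' k, (w k : ℂ) * Complex.exp (-(θ * Complex.I)) ^ k‖ ≤ A := by
      have : (r * (θ * Complex.I) : ℂ) = ((r * θ : ℝ) : ℂ) * Complex.I := by push_cast; ring
      rw [norm_mul, this, Complex.norm_exp_ofReal_mul_I, one_mul]
      exact tsum_of_norm_bounded hs.hasSum fun k => norm_mul_exp_neg_pow_le w (by simp) k
    have h2 : 1 ≤ |θ| ^ p / δ ^ p := by
      rw [le_div_iff₀ (by positivity), one_mul]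
      gcongr
    have h3 : 1 ≤ |θ| ^ (α + p) / δ ^ (α + p) := by
      rw [le_div_iff₀ (by positivity), one_mul]
      gcongr
    calc _ ≤ |θ| ^ α + A := (norm_sub_le _ _).trans (by rw [hpow]; gcongr)
      _ ≤ |θ| ^ α * (|θ| ^ p / δ ^ p) + A * (|θ| ^ (α + p) / δ ^ (α + p)) := by
          gcongr
          · exact le_mul_of_one_le_right (by positivity) h2
          · exact le_mul_of_one_le_right hA h3
      _ = (1 / δ ^ p + A / δ ^ (α + p)) * |θ| ^ (α + p) := by rw [hadd]; ring
      _ ≤ _ := by gcongr; exact le_max_right _ _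

/-! ### Decay of the Fourier transform. -/

open FourierTransform in
lemma norm_fourier_le (g : ℝ → ℂ) (ω : ℝ) : ‖𝓕 g ω‖ ≤ ∫ t, ‖g t‖ := by
  rw [Real.fourier_real_eq_integral_exp_smul]
  refine (norm_integral_le_integral_norm _).trans_eq (integral_congr_ae (.of_forall fun v => ?_))
  simp only [norm_smul, Complex.norm_exp_ofReal_mul_I, one_mul]

lemma iteratedDeriv_ofReal {N : ℕ} {f : ℝ → ℝ} (hf : ContDiff ℝ N f) {k : ℕ} (hk : k ≤ N) :
    iteratedDeriv k (fun t => (f t : ℂ)) = fun t => ((iteratedDeriv k f t : ℝ) : ℂ) := by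
  induction k with
  | zero => simp
  | succ k ih =>
    rw [iteratedDeriv_succ, ih (by omega), iteratedDeriv_succ]
    funext t
    have hd : DifferentiableAt ℝ (iteratedDeriv k f) t :=
      (hf.differentiable_iteratedDeriv k (by exact_mod_cast hk)) t
    exact hd.hasDerivAt.ofReal_comp.deriv

open FourierTransform in
lemma IsSmoothIntegrable.exists_fourier_bound {N : ℕ} {f : ℝ → ℝ} (hf : IsSmoothIntegrable N f) :
    ∃ C, ∀ ω : ℝ, ‖𝓕 (fun t => (f t : ℂ)) ω‖ ≤ C * (1 + |ω|) ^ (-(N : ℝ)) := by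
  set g := fun t => (f t : ℂ)
  have hg : ContDiff ℝ N g := Complex.ofRealCLM.contDiff.comp hf.1
  have hgi : ∀ k : ℕ, (k : ℕ∞) ≤ (N : ℕ∞) → Integrable (iteratedDeriv k g) := fun k hk => by
    rw [iteratedDeriv_ofReal hf.1 (by exact_mod_cast hk)]
    exact (hf.2 k (by exact_mod_cast hk)).ofReal
  have hN := Real.fourier_iteratedDeriv (n := N) (N := (N : ℕ∞)) (by exact_mod_cast hg) hgi le_rfl
  set A := ∫ t, ‖g t‖
  set B := ∫ t, ‖iteratedDeriv N g t‖
  -- From `(1 + |ω|)^N ≤ 2^{N-1} (1 + |ω|^N)`; `A` bounds the transform of `f`, and `B` that of its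
  -- `N`-th derivative.
  refine ⟨2 ^ (N - 1) * (A + B), fun ω => ?_⟩
  have h1 := norm_fourier_le g ω
  have h2 := norm_fourier_le (iteratedDeriv N g) ω
  rw [hN] at h2
  simp only [norm_smul, norm_pow, norm_mul, Complex.norm_I, mul_one, Complex.norm_real,
    Real.norm_eq_abs, Complex.norm_ofNat, abs_of_pos Real.pi_pos] at h2
  have hpi : (1 : ℝ) ≤ 2 * Real.pi := by linarith [Real.pi_gt_three]
  have h3 : |ω| ^ N * ‖𝓕 g ω‖ ≤ B := by
    refine le_trans ?_ h2
    gcongr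
    exact le_mul_of_one_le_left (abs_nonneg _) hpi
  rw [Real.rpow_neg (by positivity), Real.rpow_natCast, ← div_eq_mul_inv,
    le_div_iff₀ (by positivity)]
  calc ‖𝓕 g ω‖ * (1 + |ω|) ^ N ≤ ‖𝓕 g ω‖ * (2 ^ (N - 1) * (1 ^ N + |ω| ^ N)) := by
        gcongr
        exact add_pow_le zero_le_one (abs_nonneg _) N
    _ = 2 ^ (N - 1) * (‖𝓕 g ω‖ + |ω| ^ N * ‖𝓕 g ω‖) := by rw [one_pow]; ring
    _ ≤ _ := by gcongr

lemma integrable_comp_abs {φ : ℝ → ℝ} (hφ : IntegrableOn φ (Set.Ioi 0)) :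
    Integrable fun x => φ |x| := by
  have h1 : IntegrableOn (fun x => φ |x|) (Set.Ioi 0) :=
    hφ.congr_fun (fun x hx => by simp only [abs_of_pos (Set.mem_Ioi.1 hx)]) measurableSet_Ioi
  have h2 : IntegrableOn (fun x => φ |x|) (Set.Iic 0) := by
    rw [← Measure.map_neg_eq_self (volume : Measure ℝ)]
    let m : MeasurableEmbedding fun x : ℝ => -x := (Homeomorph.neg ℝ).measurableEmbedding
    rw [m.integrableOn_map_iff]
    simp_rw [Function.comp_def, abs_neg, Set.neg_preimage, Set.neg_Iic, neg_zero]
    exact (integrableOn_Ici_iff_integrableOn_Ioi (by simp)).2 h1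
  rw [← integrableOn_univ, ← Set.Iic_union_Ioi (a := (0 : ℝ))]
  exact h2.union h1

/-- Near `0` only `a > -1` matters; at infinity the comparison is with `x^{a-b}`, `a - b < -1`.
Negative `a` occurs for fractional integrals. -/
lemma integrable_abs_rpow_mul_one_add_abs_rpow {a b : ℝ} (ha : -1 < a) (hab : a + 1 < b) :
    Integrable fun x : ℝ => |x| ^ a * (1 + |x|) ^ (-b) := by
  refine integrable_comp_abs (φ := fun x => x ^ a * (1 + x) ^ (-b)) ?_
  have hm : ∀ s : Set ℝ, AEStronglyMeasurable (fun x : ℝ => x ^ a * (1 + x) ^ (-b))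
      (volume.restrict s) := fun s => by
    have : Measurable fun x : ℝ => x ^ a * (1 + x) ^ (-b) := by fun_prop
    exact this.aestronglyMeasurable
  rw [← Set.Ioc_union_Ioi_eq_Ioi zero_le_one]
  refine IntegrableOn.union ?_ ?_
  · have h1 : IntegrableOn (fun x : ℝ => x ^ a) (Set.Ioc 0 1) :=
      (intervalIntegrable_iff_integrableOn_Ioc_of_le zero_le_one).1
        (intervalIntegral.intervalIntegrable_rpow' ha)
    refine h1.mono' (hm _) ?_
    filter_upwards [ae_restrict_mem measurableSet_Ioc] with x hx
    have hx0 : 0 < x := hx.1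
    rw [Real.norm_eq_abs, abs_of_nonneg (by positivity)]
    refine mul_le_of_le_one_right (by positivity) ?_
    exact Real.rpow_le_one_of_one_le_of_nonpos (by linarith) (by linarith)
  · have h1 : IntegrableOn (fun x : ℝ => x ^ (a - b)) (Set.Ioi 1) :=
      integrableOn_Ioi_rpow_of_lt (by linarith) one_pos
    refine h1.mono' (hm _) ?_
    filter_upwards [ae_restrict_mem measurableSet_Ioi] with x hx
    have hx0 : (0 : ℝ) < x := one_pos.trans hx
    rw [Real.norm_eq_abs, abs_of_nonneg (by positivity), sub_eq_add_neg, Real.rpow_add hx0]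
    refine mul_le_mul_of_nonneg_left ?_ (by positivity)
    exact Real.rpow_le_rpow_of_nonpos hx0 (by linarith) (by linarith)

open FourierTransform in
lemma aestronglyMeasurable_fourier {g : ℝ → ℂ} (hg : Integrable g) :
    AEStronglyMeasurable (𝓕 g) := by
  have : ContDiff ℝ ((0 : ℕ∞) : WithTop ℕ∞) (𝓕 g) := Real.contDiff_fourier fun n hn => by
    have : n = 0 := by simpa using hn
    subst this
    simpa using hg.norm
  exact this.continuous.aestronglyMeasurable

open FourierTransform in
lemma IsSmoothIntegrable.integrable_rpow_mul_fourier {N : ℕ} {f : ℝ → ℝ}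
    (hf : IsSmoothIntegrable N f) {a : ℝ} (ha : -1 < a) (haN : a + 1 < N) :
    Integrable fun ω : ℝ => |ω| ^ a * ‖𝓕 (fun t => (f t : ℂ)) ω‖ := by
  obtain ⟨C, hC⟩ := hf.exists_fourier_bound
  refine ((integrable_abs_rpow_mul_one_add_abs_rpow ha haN).const_mul C).mono' ?_ ?_
  · have h1 : Measurable fun ω : ℝ => |ω| ^ a := by fun_prop
    have h2 : Integrable fun t => (f t : ℂ) := by
      simpa using (hf.2 0 (Nat.zero_le _)).ofReal (𝕜 := ℂ)
    exact h1.aestronglyMeasurable.mul (aestronglyMeasurable_fourier h2).norm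
  · refine .of_forall fun ω => ?_
    rw [Real.norm_eq_abs, abs_of_nonneg (by positivity)]
    calc _ ≤ |ω| ^ a * (C * (1 + |ω|) ^ (-(N : ℝ))) := by gcongr; exact hC ω
      _ = _ := by ring

/-! ### The fractional integral as a Fourier multiplier. -/

lemma integrableOn_rpow_mul_cexp_neg_mul {a : ℝ} (ha : -1 < a) {z : ℂ} (hz : 0 < z.re) :
    IntegrableOn (fun u : ℝ => ((u ^ a : ℝ) : ℂ) * Complex.exp (-(z * u))) (Set.Ioi 0) := by
  have h1 := integrableOn_rpow_mul_exp_neg_mul_rpow ha one_pos hz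
  refine h1.mono' (by fun_prop) ?_
  filter_upwards [ae_restrict_mem measurableSet_Ioi] with u hu
  rw [norm_mul, Complex.norm_exp, Complex.norm_real, Real.norm_eq_abs,
    abs_of_nonneg (Real.rpow_nonneg (Set.mem_Ioi.1 hu).le _), Real.rpow_one]
  simp

/-- Euler's integral for the Gamma function along a complex direction. -/
lemma integral_rpow_mul_cexp_neg_mul {b : ℝ} (hb : 0 < b) {z : ℂ} (hz : 0 < z.re) :
    ∫ u in Set.Ioi (0 : ℝ), ((u ^ (b - 1) : ℝ) : ℂ) * Complex.exp (-(z * u)) =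
      (Real.Gamma b : ℂ) * z ^ (-(b : ℂ)) := by
  set U : Set ℂ := {z | 0 < z.re}
  have hUo : IsOpen U := isOpen_lt continuous_const Complex.continuous_re
  have a1 : AnalyticOnNhd ℂ (fun z : ℂ => ∫ u in Set.Ioi (0 : ℝ),
      ((u ^ (b - 1) : ℝ) : ℂ) * Complex.exp (-(z * u))) U := by
    refine DifferentiableOn.analyticOnNhd (fun z hz => ?_) hUo
    have hz : 0 < z.re := hz
    refine DifferentiableAt.differentiableWithinAt ?_
    -- On the neighbourhood `Re z' > Re z / 2` the exponential decay is uniform, which gives the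
    -- dominating function.
    refine (hasDerivAt_integral_of_dominated_loc_of_deriv_le
      (s := {z' : ℂ | z.re / 2 < z'.re})
      (F' := fun z' (u : ℝ) => ((u ^ (b - 1) : ℝ) : ℂ) * (Complex.exp (-(z' * u)) * -(u : ℂ)))
      (bound := fun u => u ^ b * Real.exp (-(z.re / 2) * u ^ (1 : ℝ)))
      ?_ ?_ ?_ ?_ ?_ ?_ ?_).2.differentiableAt
    · exact (isOpen_lt continuous_const Complex.continuous_re).mem_nhds (by
        show z.re / 2 < z.re; linarith)
    · exact .of_forall fun z' => by fun_prop
    · exact integrableOn_rpow_mul_cexp_neg_mul (by linarith) hz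
    · fun_prop
    · filter_upwards [ae_restrict_mem measurableSet_Ioi] with u hu z' hz'
      have hu : 0 < u := hu
      have hz' : z.re / 2 < z'.re := hz'
      rw [norm_mul, norm_mul, Complex.norm_exp, Complex.norm_real, norm_neg, Complex.norm_real,
        Real.norm_eq_abs, Real.norm_eq_abs, abs_of_pos hu, abs_of_pos (by positivity),
        mul_comm (Real.exp _), ← mul_assoc, ← Real.rpow_add_one hu.ne', sub_add_cancel,
        Real.rpow_one]
      gcongr
      simp
      nlinarith
    · exact integrableOn_rpow_mul_exp_neg_mul_rpow (by linarith) one_pos (by linarith)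
    · refine .of_forall fun u z' _ => ?_
      have h1 : HasDerivAt (fun z' : ℂ => -(z' * (u : ℂ))) (-(u : ℂ)) z' := by
        have := ((hasDerivAt_id z').mul_const (u : ℂ)).fun_neg
        simpa using this
      exact (h1.cexp).const_mul _
  have a2 : AnalyticOnNhd ℂ (fun z : ℂ => (Real.Gamma b : ℂ) * z ^ (-(b : ℂ))) U := by
    refine DifferentiableOn.analyticOnNhd (fun z hz => ?_) hUo
    exact ((differentiableAt_id.cpow_const (Or.inl hz)).const_mul _).differentiableWithinAt
  -- Both sides are holomorphic in the half plane and agree on the positive reals by the real Gamma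
  -- integral.
  refine a1.eqOn_of_preconnected_of_frequently_eq a2
    (convex_halfSpace_re_gt 0).isPreconnected (z₀ := ((1 : ℝ) : ℂ)) (by simp [U]) ?_ hz
  have ht : Tendsto (fun x : ℝ => (x : ℂ)) (𝓝[≠] 1) (𝓝[≠] ((1 : ℝ) : ℂ)) := by
    refine (Complex.continuous_ofReal.continuousWithinAt).tendsto_nhdsWithin fun x hx => ?_
    simpa only [Set.mem_compl_iff, Set.mem_singleton_iff, Complex.ofReal_inj] using hx
  refine ht.frequently (Eventually.frequently ?_)
  have hnhds : Set.Ioi (0 : ℝ) ∈ 𝓝[≠] (1 : ℝ) := mem_nhdsWithin_of_mem_nhds (Ioi_mem_nhds one_pos)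
  filter_upwards [hnhds] with x hx
  have hx : 0 < x := hx
  have h1 := Real.integral_rpow_mul_exp_neg_mul_Ioi hb hx
  have h2 : ∀ u : ℝ, ((u ^ (b - 1) : ℝ) : ℂ) * Complex.exp (-((x : ℂ) * u)) =
      ((u ^ (b - 1) * Real.exp (-(x * u)) : ℝ) : ℂ) := fun u => by push_cast; rfl
  simp_rw [h2]
  rw [integral_complex_ofReal, h1, mul_comm, one_div, Real.inv_rpow hx.le, ← Real.rpow_neg hx.le]
  push_cast
  rw [Complex.ofReal_cpow hx.le]
  push_cast
  rfl

/-- The symbol `2 π i ω` of the derivative. -/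
noncomputable def freq (ω : ℝ) : ℂ := ((2 * Real.pi * ω : ℝ) : ℂ) * Complex.I

lemma continuous_freq : Continuous freq := by unfold freq; fun_prop

lemma freq_re (ω : ℝ) : (freq ω).re = 0 := by simp [freq]

lemma norm_freq (ω : ℝ) : ‖freq ω‖ = 2 * Real.pi * |ω| := by
  simp [freq, abs_of_pos Real.pi_pos]

lemma norm_exp_freq_mul (ω y : ℝ) : ‖Complex.exp (freq ω * y)‖ = 1 := by
  rw [Complex.norm_exp]; simp [freq]

lemma freq_mem_slitPlane {ω : ℝ} (hω : ω ≠ 0) : freq ω ∈ Complex.slitPlane :=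
  Or.inr (by simp [freq, hω, Real.pi_ne_zero])

open FourierTransform in
lemma IsSmoothIntegrable.integrable_fourier {N : ℕ} {f : ℝ → ℝ}
    (hf : IsSmoothIntegrable N f) (hN : 2 ≤ N) : Integrable (𝓕 fun t => (f t : ℂ)) := by
  have hN' : (2 : ℝ) ≤ N := by exact_mod_cast hN
  have h1 := hf.integrable_rpow_mul_fourier (a := 0) (by norm_num) (by linarith)
  have h2 : Integrable fun t => (f t : ℂ) := by
    simpa using (hf.2 0 (Nat.zero_le _)).ofReal (𝕜 := ℂ)
  simp only [Real.rpow_zero, one_mul] at h1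
  exact (integrable_norm_iff (aestronglyMeasurable_fourier h2)).1 h1

open FourierTransform in
lemma IsSmoothIntegrable.eq_integral_fourier {N : ℕ} {f : ℝ → ℝ}
    (hf : IsSmoothIntegrable N f) (hN : 2 ≤ N) (y : ℝ) :
    (f y : ℂ) = ∫ ω, Complex.exp (freq ω * y) * 𝓕 (fun t => (f t : ℂ)) ω := by
  have h2 : Integrable fun t => (f t : ℂ) := by
    simpa using (hf.2 0 (Nat.zero_le _)).ofReal (𝕜 := ℂ)
  have h3 : Continuous fun t => (f t : ℂ) := Complex.continuous_ofReal.comp hf.1.continuous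
  have := congrFun (h3.fourierInv_fourier_eq h2 (hf.integrable_fourier hN)) y
  rw [Real.fourierInv_eq'] at this
  rw [← this]
  refine integral_congr_ae (.of_forall fun ω => ?_)
  simp only [freq, smul_eq_mul]
  congr 2
  simp
  ring

lemma integrableOn_rpow_mul_comp_sub {b : ℝ} (hb : 0 < b) (hb1 : b < 1) {f : ℝ → ℝ}
    (hc : Continuous f) (hi : Integrable f) (y : ℝ) :
    IntegrableOn (fun u : ℝ => u ^ (b - 1) * f (y - u)) (Set.Ioi 0) := by
  have hm : Measurable fun u : ℝ => u ^ (b - 1) := by fun_prop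
  have hcy : Continuous fun u : ℝ => f (y - u) := by fun_prop
  rw [← Set.Ioc_union_Ioi_eq_Ioi zero_le_one]
  refine IntegrableOn.union ?_ ?_
  · have h1 : IntegrableOn (fun x : ℝ => x ^ (b - 1)) (Set.Icc 0 1) := by
      rw [integrableOn_Icc_iff_integrableOn_Ioc]
      exact (intervalIntegrable_iff_integrableOn_Ioc_of_le zero_le_one).1
        (intervalIntegral.intervalIntegrable_rpow' (by linarith))
    exact (h1.mul_continuousOn hcy.continuousOn isCompact_Icc).mono_set Set.Ioc_subset_Icc_self
  · refine ((hi.comp_sub_left y).norm.integrableOn).mono'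
      (hm.aestronglyMeasurable.mul hcy.aestronglyMeasurable) ?_
    filter_upwards [ae_restrict_mem measurableSet_Ioi] with u hu
    have hu : 1 < u := hu
    rw [norm_mul, Real.norm_eq_abs, abs_of_nonneg (by positivity)]
    refine mul_le_of_le_one_left (norm_nonneg _) ?_
    exact Real.rpow_le_one_of_one_le_of_nonpos hu.le (by linarith)

/-- The damping `e^{-εu}` makes the kernel integrable at infinity, so Fubini applies; it is removed
later by `ε → 0+`. -/
lemma integral_rpow_mul_exp_mul_comp_sub {b : ℝ} (hb : 0 < b) {f : ℝ → ℝ} {F : ℝ → ℂ}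
    (hF : Integrable F) (hf : ∀ y : ℝ, (f y : ℂ) = ∫ ω, Complex.exp (freq ω * y) * F ω)
    {ε : ℝ} (hε : 0 < ε) (y : ℝ) :
    ∫ u in Set.Ioi (0 : ℝ), ((u ^ (b - 1) : ℝ) : ℂ) * Complex.exp (-(ε * u)) * (f (y - u) : ℂ) =
      ∫ ω, Complex.exp (freq ω * y) * F ω * ((Real.Gamma b : ℂ) *
        ((ε : ℂ) + freq ω) ^ (-(b : ℂ))) := by
  have hK := integrableOn_rpow_mul_cexp_neg_mul (a := b - 1) (by linarith) (z := ε)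
    (by simpa using hε)
  have hcont : Continuous fun q : ℝ × ℝ => Complex.exp (freq q.2 * ((y - q.1 : ℝ) : ℂ)) := by
    have := continuous_freq
    fun_prop
  have hint : Integrable (Function.uncurry fun u ω : ℝ =>
      (((u ^ (b - 1) : ℝ) : ℂ) * Complex.exp (-(ε * u)) * F ω) *
        Complex.exp (freq ω * ((y - u : ℝ) : ℂ)))
      ((volume.restrict (Set.Ioi 0)).prod volume) := by
    have h1 := hK.integrable.mul_prod hF
    refine h1.norm.mono' (h1.aestronglyMeasurable.mul hcont.aestronglyMeasurable) ?_
    refine .of_forall fun q => ?_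
    simp only [Function.uncurry]
    rw [norm_mul, norm_exp_freq_mul, mul_one]
  have h1 := integral_integral_swap hint
  calc _ = ∫ u in Set.Ioi (0 : ℝ), ∫ ω, (((u ^ (b - 1) : ℝ) : ℂ) * Complex.exp (-(ε * u)) * F ω) *
        Complex.exp (freq ω * ((y - u : ℝ) : ℂ)) := by
        refine integral_congr_ae (.of_forall fun u => ?_)
        simp only
        rw [hf, ← integral_const_mul]
        refine integral_congr_ae (.of_forall fun ω => ?_)
        simp only
        ring
    _ = _ := h1
    _ = _ := by
        refine integral_congr_ae (.of_forall fun ω => ?_)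
        simp only
        rw [← integral_rpow_mul_cexp_neg_mul hb (z := (ε : ℂ) + freq ω)
          (by simpa [freq_re] using hε), ← integral_const_mul]
        refine integral_congr_ae (.of_forall fun u => ?_)
        simp only
        have : Complex.exp (freq ω * ((y - u : ℝ) : ℂ)) * Complex.exp (-(ε * u)) =
            Complex.exp (freq ω * y) * Complex.exp (-((ε + freq ω) * u)) := by
          rw [← Complex.exp_add, ← Complex.exp_add]
          congr 1
          push_cast
          ring
        linear_combination ((u ^ (b - 1) : ℝ) : ℂ) * F ω * this

/-- The fractional integral of `f` in terms of the Fourier transform. -/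
lemma integral_div_rpow_eq {b : ℝ} (hb : 0 < b) (hb1 : b < 1) {f : ℝ → ℝ} {F : ℝ → ℂ}
    (hc : Continuous f) (hi : Integrable f) (hF : Integrable F)
    (hFb : Integrable fun ω => |ω| ^ (-b) * ‖F ω‖)
    (hf : ∀ y : ℝ, (f y : ℂ) = ∫ ω, Complex.exp (freq ω * y) * F ω) (y : ℝ) :
    ((∫ t in Set.Iio y, f t / (y - t) ^ (1 - b) : ℝ) : ℂ) =
      ∫ ω, Complex.exp (freq ω * y) * F ω * ((Real.Gamma b : ℂ) * freq ω ^ (-(b : ℂ))) := by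
  have hbound := integrableOn_rpow_mul_comp_sub hb hb1 hc hi y
  have e1 : ((∫ t in Set.Iio y, f t / (y - t) ^ (1 - b) : ℝ) : ℂ) =
      ∫ u in Set.Ioi (0 : ℝ), ((u ^ (b - 1) : ℝ) : ℂ) * Complex.exp (-((0 : ℝ) * u)) *
        (f (y - u) : ℂ) := by
    rw [setIntegral_Iio_eq_Ioi, ← integral_complex_ofReal]
    refine setIntegral_congr_fun measurableSet_Ioi fun u hu => ?_
    have hu : 0 < u := hu
    simp only [sub_sub_cancel, Complex.ofReal_zero, zero_mul, neg_zero, Complex.exp_zero, mul_one]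
    rw [show 1 - b = -(b - 1) by ring, Real.rpow_neg hu.le, div_inv_eq_mul, mul_comm]
    push_cast
    rfl
  have t1 : Tendsto (fun ε : ℝ => ∫ u in Set.Ioi (0 : ℝ), ((u ^ (b - 1) : ℝ) : ℂ) *
      Complex.exp (-(ε * u)) * (f (y - u) : ℂ)) (𝓝[>] 0)
      (𝓝 (((∫ t in Set.Iio y, f t / (y - t) ^ (1 - b) : ℝ) : ℂ))) := by
    rw [e1]
    refine tendsto_integral_filter_of_dominated_convergence
      (fun u => ‖u ^ (b - 1) * f (y - u)‖) ?_ ?_ hbound.norm ?_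
    · refine .of_forall fun ε => ?_
      have : Measurable fun u : ℝ => ((u ^ (b - 1) : ℝ) : ℂ) * Complex.exp (-(ε * u)) := by
        fun_prop
      have h2 : Continuous fun u : ℝ => (f (y - u) : ℂ) := by fun_prop
      exact this.aestronglyMeasurable.mul h2.aestronglyMeasurable
    · filter_upwards [self_mem_nhdsWithin] with ε hε
      filter_upwards [ae_restrict_mem measurableSet_Ioi] with u hu
      have : ‖Complex.exp (-(ε * u))‖ ≤ 1 := by
        rw [Complex.norm_exp, Real.exp_le_one_iff]
        have := mul_pos (Set.mem_Ioi.1 hε) (Set.mem_Ioi.1 hu)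
        simp
        linarith
      rw [mul_right_comm, norm_mul, ← Complex.ofReal_mul, Complex.norm_real]
      exact mul_le_of_le_one_right (norm_nonneg _) this
    · refine .of_forall fun u => ?_
      have : Continuous fun ε : ℝ => ((u ^ (b - 1) : ℝ) : ℂ) *
        Complex.exp (-(ε * u)) * (f (y - u) : ℂ) := by fun_prop
      exact (this.tendsto 0).mono_left nhdsWithin_le_nhds
  have t2 : Tendsto (fun ε : ℝ => ∫ ω, Complex.exp (freq ω * y) * F ω * ((Real.Gamma b : ℂ) *
        ((ε : ℂ) + freq ω) ^ (-(b : ℂ)))) (𝓝[>] 0)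
      (𝓝 (∫ ω, Complex.exp (freq ω * y) * F ω * ((Real.Gamma b : ℂ) * freq ω ^ (-(b : ℂ))))) := by
    refine tendsto_integral_filter_of_dominated_convergence
      (fun ω => (Real.Gamma b * (2 * Real.pi) ^ (-b)) * (|ω| ^ (-b) * ‖F ω‖)) ?_ ?_
      (hFb.const_mul _) ?_
    · refine .of_forall fun ε => ?_
      have h1 : Continuous fun ω : ℝ => Complex.exp (freq ω * y) := by
        have := continuous_freq
        fun_prop
      have h2 : Measurable fun ω : ℝ => (Real.Gamma b : ℂ) * ((ε : ℂ) + freq ω) ^ (-(b : ℂ)) := by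
        have := continuous_freq.measurable
        fun_prop
      exact (h1.aestronglyMeasurable.mul hF.aestronglyMeasurable).mul h2.aestronglyMeasurable
    · filter_upwards [self_mem_nhdsWithin] with ε hε
      have hne : ∀ᵐ ω : ℝ, ω ≠ 0 := by simp [ae_iff]
      filter_upwards [hne] with ω hω
      -- Adding real `ε` to an imaginary number increases its modulus; with exponent `-b < 0` this
      -- gives a bound independent of `ε`.
      have h1 : ‖freq ω‖ ≤ ‖(ε : ℂ) + freq ω‖ := by
        have h2 : ‖freq ω‖ = |((ε : ℂ) + freq ω).im| := by
          simp [freq, abs_of_pos Real.pi_pos]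
        rw [h2]
        exact Complex.abs_im_le_norm _
      have h0 : 0 < ‖freq ω‖ := by rw [norm_freq]; positivity
      rw [norm_mul, norm_mul, norm_mul, norm_exp_freq_mul, one_mul, Complex.norm_real,
        Real.norm_eq_abs, abs_of_pos (Real.Gamma_pos_of_pos hb), ← Complex.ofReal_neg,
        Complex.norm_cpow_real]
      calc _ ≤ ‖F ω‖ * (Real.Gamma b * ‖freq ω‖ ^ (-b)) := by
            have := Real.Gamma_pos_of_pos hb
            gcongr ?_ * (?_ * ?_)
            exact Real.rpow_le_rpow_of_nonpos h0 h1 (by linarith)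
        _ = _ := by
            rw [norm_freq, Real.mul_rpow (by positivity) (abs_nonneg _)]
            ring
    · have hne : ∀ᵐ ω : ℝ, ω ≠ 0 := by simp [ae_iff]
      filter_upwards [hne] with ω hω
      refine (Tendsto.const_mul _ ?_).const_mul _
      have h1 : Tendsto (fun ε : ℝ => (ε : ℂ) + freq ω) (𝓝[>] 0) (𝓝 (freq ω)) := by
        have : Continuous fun ε : ℝ => (ε : ℂ) + freq ω := by fun_prop
        have := (this.tendsto 0).mono_left (nhdsWithin_le_nhds (s := Set.Ioi 0))
        simpa using this
      exact (continuousAt_cpow_const (freq_mem_slitPlane hω)).tendsto.comp h1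
  refine tendsto_nhds_unique t1 (t2.congr' ?_)
  filter_upwards [self_mem_nhdsWithin] with ε hε
  exact (integral_rpow_mul_exp_mul_comp_sub hb hF hf hε y).symm

/-! ### Derivative and difference operator as Fourier multipliers. -/

open FourierTransform in
lemma fourier_comp_neg_apply (H : ℝ → ℂ) (y : ℝ) :
    𝓕 (fun ω => H (-ω)) y = ∫ ω, Complex.exp (freq ω * y) * H ω := by
  rw [Real.fourier_real_eq_integral_exp_smul,
    ← integral_neg_eq_self (fun ω => Complex.exp (freq ω * y) * H ω)]
  refine integral_congr_ae (.of_forall fun ω => ?_)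
  simp only [freq, smul_eq_mul]
  congr 2
  push_cast
  ring

open FourierTransform in
-- The integral is the Fourier transform of `H(-ω)`, so differentiation under the integral reduces
-- to that of a Fourier transform.
lemma contDiff_and_iteratedDeriv_integral_exp {n : ℕ} {H : ℝ → ℂ}
    (hH : ∀ k ≤ n, Integrable fun ω : ℝ => |ω| ^ k * ‖H ω‖) (hm : AEStronglyMeasurable H) :
    ContDiff ℝ n (fun y : ℝ => ∫ ω, Complex.exp (freq ω * y) * H ω) ∧
    ∀ x, iteratedDeriv n (fun y : ℝ => ∫ ω, Complex.exp (freq ω * y) * H ω) x =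
      ∫ ω, Complex.exp (freq ω * x) * (freq ω ^ n * H ω) := by
  have e : (fun y : ℝ => ∫ ω, Complex.exp (freq ω * y) * H ω) = 𝓕 fun ω => H (-ω) :=
    funext fun y => (fourier_comp_neg_apply H y).symm
  have hH' : ∀ k ≤ n, Integrable fun ω : ℝ => ‖ω‖ ^ k * ‖H (-ω)‖ := fun k hk => by
    simpa using (hH k hk).comp_neg
  have hm' : AEStronglyMeasurable fun ω : ℝ => H (-ω) :=
    hm.comp_quasiMeasurePreserving (Measure.measurePreserving_neg volume).quasiMeasurePreserving
  rw [e]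
  refine ⟨?_, fun x => ?_⟩
  · exact_mod_cast Real.contDiff_fourier (N := (n : ℕ∞))
      fun k hk => hH' k (by exact_mod_cast hk)
  · rw [Real.iteratedDeriv_fourier (N := (n : ℕ∞)) (fun k hk => ?_) le_rfl,
      ← fourier_comp_neg_apply]
    · refine congrFun (congrArg _ (funext fun ω => ?_)) x
      simp only [freq, smul_eq_mul]
      congr 2
      push_cast
      ring
    · refine (hH' k (by exact_mod_cast hk)).mono'
        ((continuous_pow k).aestronglyMeasurable.smul hm') (.of_forall fun ω => ?_)
      rw [norm_smul, norm_pow]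

lemma freq_ne_zero {ω : ℝ} (hω : ω ≠ 0) : freq ω ≠ 0 :=
  Complex.slitPlane_ne_zero (freq_mem_slitPlane hω)

lemma ae_ne_zero : ∀ᵐ ω : ℝ, ω ≠ 0 := by simp [ae_iff]

open FourierTransform in
/-- The Riemann–Liouville derivative as a Fourier multiplier. -/
theorem leftDeriv_eq_integral_fourier {α : ℝ} {n N : ℕ} (hn : (n : ℝ) - 1 < α) (hn' : α < n)
    (hα : 0 < α) (hN : α + 1 < N) {f : ℝ → ℝ} (hf : IsSmoothIntegrable N f) (x : ℝ) :
    (leftDeriv α f x : ℂ) =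
      ∫ ω, Complex.exp (freq ω * x) * 𝓕 (fun t => (f t : ℂ)) ω * freq ω ^ (α : ℂ) := by
  have hN2 : 2 ≤ N := by
    have : (1 : ℝ) < N := by linarith
    exact_mod_cast this
  set F := 𝓕 fun t => (f t : ℂ)
  have hfloor : ⌊α⌋₊ + 1 = n := by
    have hn0 : 0 < n := by
      have : (0 : ℝ) < n := hα.trans hn'
      exact_mod_cast this
    have : ⌊α⌋₊ = n - 1 := by
      rw [Nat.floor_eq_iff hα.le]
      push_cast [Nat.one_le_iff_ne_zero.2 hn0.ne']
      exact ⟨hn.le, by linarith⟩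
    omega
  set b : ℝ := n - α with hb
  have hb0 : 0 < b := by linarith
  have hb1 : b < 1 := by linarith
  have hF := hf.integrable_fourier hN2
  have hΓ := Real.Gamma_pos_of_pos hb0
  set H : ℝ → ℂ := fun ω => F ω * ((Real.Gamma b : ℂ) * freq ω ^ (-(b : ℂ))) with hHdef
  have hJ : (fun y => ((∫ t in Set.Iio y, f t / (y - t) ^ (α + 1 - (n : ℝ)) : ℝ) : ℂ)) =
      fun y : ℝ => ∫ ω, Complex.exp (freq ω * y) * H ω := by
    funext y
    rw [show α + 1 - (n : ℝ) = 1 - b by rw [hb]; ring,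
      integral_div_rpow_eq hb0 hb1 hf.1.continuous (by simpa using hf.2 0 (Nat.zero_le _)) hF
        (hf.integrable_rpow_mul_fourier (by linarith) (by linarith)) (hf.eq_integral_fourier hN2)]
    simp only [hHdef, mul_assoc, F]
  have hHm : AEStronglyMeasurable H := by
    have h2 : Measurable fun ω : ℝ => (Real.Gamma b : ℂ) * freq ω ^ (-(b : ℂ)) := by
      have := continuous_freq.measurable
      fun_prop
    exact hF.aestronglyMeasurable.mul h2.aestronglyMeasurable
  -- The weight is `|ω|^{k-b}`: `k - b ≥ -b > -1` at the origin, and `k - b + 1 ≤ α + 1 < N` at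
  -- infinity.
  have hHi : ∀ k ≤ n, Integrable fun ω : ℝ => |ω| ^ k * ‖H ω‖ := by
    intro k hk
    have hk' : (k : ℝ) ≤ n := by exact_mod_cast hk
    have h1 := hf.integrable_rpow_mul_fourier (a := k - b)
      (by linarith [k.cast_nonneg (α := ℝ)]) (by rw [hb]; linarith)
    refine (h1.const_mul (Real.Gamma b * (2 * Real.pi) ^ (-b))).congr ?_
    filter_upwards [ae_ne_zero] with ω hω
    simp only [hHdef, F]
    rw [norm_mul, norm_mul, Complex.norm_real, Real.norm_eq_abs, abs_of_pos hΓ,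
      ← Complex.ofReal_neg, Complex.norm_cpow_real, norm_freq,
      Real.mul_rpow (by positivity) (abs_nonneg _), sub_eq_add_neg,
      Real.rpow_add (abs_pos.2 hω), Real.rpow_natCast]
    ring
  obtain ⟨hcd, hder⟩ := contDiff_and_iteratedDeriv_integral_exp hHi hHm
  rw [← hJ] at hcd
  have hcd' : ContDiff ℝ n fun y => ∫ t in Set.Iio y, f t / (y - t) ^ (α + 1 - (n : ℝ)) :=
    Complex.reCLM.contDiff.comp hcd
  have h3 := congrFun (iteratedDeriv_ofReal hcd' le_rfl) x
  rw [hJ, hder] at h3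
  unfold leftDeriv
  rw [hfloor, Complex.ofReal_mul, ← h3, ← hb, ← integral_const_mul]
  refine integral_congr_ae ?_
  filter_upwards [ae_ne_zero] with ω hω
  have e1 : freq ω ^ (α : ℂ) = freq ω ^ n * freq ω ^ (-(b : ℂ)) := by
    rw [← Complex.cpow_natCast, ← Complex.cpow_add _ _ (freq_ne_zero hω)]
    congr 1
    rw [hb]
    push_cast
    ring
  have e2 : ((1 / Real.Gamma b : ℝ) : ℂ) * (Real.Gamma b : ℂ) = 1 := by
    rw [← Complex.ofReal_mul, one_div_mul_cancel hΓ.ne', Complex.ofReal_one]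
  simp only [hHdef]
  rw [e1]
  linear_combination (Complex.exp (freq ω * x) * F ω * (freq ω ^ n * freq ω ^ (-(b : ℂ)))) * e2

open FourierTransform in
/-- The difference operator as a Fourier multiplier. -/
theorem leftDiff_eq_integral_fourier {α r : ℝ} {N : ℕ} (hN : 2 ≤ N) {f : ℝ → ℝ}
    (hf : IsSmoothIntegrable N f) {w : ℕ → ℝ} (hs : Summable fun k => |w k|) (h x : ℝ) :
    (leftDiff α r w h f x : ℂ) =
      ∫ ω, Complex.exp (freq ω * x) * 𝓕 (fun t => (f t : ℂ)) ω * (((1 / h ^ α : ℝ) : ℂ) *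
        (Complex.exp (r * (freq ω * h)) * ∑' k, (w k : ℂ) * Complex.exp (-(freq ω * h)) ^ k)) := by
  set F := 𝓕 fun t => (f t : ℂ)
  have hF : Integrable F := hf.integrable_fourier hN
  set G : ℕ → ℝ → ℂ := fun k ω =>
    (w k : ℂ) * (Complex.exp (freq ω * ((x - (k - r) * h : ℝ) : ℂ)) * F ω) with hG
  have hnorm : ∀ k ω, ‖G k ω‖ = |w k| * ‖F ω‖ := fun k ω => by
    simp only [hG]
    rw [norm_mul, norm_mul, norm_exp_freq_mul, one_mul, Complex.norm_real, Real.norm_eq_abs]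
  have hGi : ∀ k, Integrable (G k) := fun k => by
    have h1 : Continuous fun ω : ℝ => Complex.exp (freq ω * ((x - (k - r) * h : ℝ) : ℂ)) := by
      have := continuous_freq
      fun_prop
    refine (hF.norm.const_mul |w k|).mono'
      ((h1.aestronglyMeasurable.mul hF.aestronglyMeasurable).const_mul _) (.of_forall fun ω => ?_)
    exact (hnorm k ω).le
  -- Sum and integral commute because the `L¹` norms are `|w k|` times that of `F`.
  have hsum := hasSum_integral_of_summable_integral_norm hGi (by
    simp only [hnorm, integral_const_mul]
    exact hs.mul_right _)
  unfold leftDiff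
  rw [Complex.ofReal_mul, Complex.ofReal_tsum]
  have e1 : ∀ k : ℕ, ((w k * f (x - ((k : ℝ) - r) * h) : ℝ) : ℂ) = ∫ ω, G k ω := fun k => by
    rw [Complex.ofReal_mul, hf.eq_integral_fourier hN, ← integral_const_mul]
  simp_rw [e1]
  rw [hsum.tsum_eq, ← integral_const_mul]
  refine integral_congr_ae (.of_forall fun ω => ?_)
  simp only
  have e2 : ∑' k, G k ω = Complex.exp (freq ω * x) * F ω * (Complex.exp (r * (freq ω * h)) *
      ∑' k, (w k : ℂ) * Complex.exp (-(freq ω * h)) ^ k) := by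
    rw [← mul_assoc, ← tsum_mul_left]
    refine tsum_congr fun k => ?_
    have : Complex.exp (freq ω * ((x - (k - r) * h : ℝ) : ℂ)) =
        Complex.exp (freq ω * x) * Complex.exp (r * (freq ω * h)) *
          Complex.exp (-(freq ω * h)) ^ k := by
      rw [← Complex.exp_nat_mul, ← Complex.exp_add, ← Complex.exp_add]
      congr 1
      push_cast
      ring
    simp only [hG]
    rw [this]
    ring
  rw [e2]
  ring

/-! ### The error integral and the equivalence. -/

open FourierTransform in
-- At `θ = 2πωh` the symbol bound, divided by `h^α`, is `h^p` times a multiple of `|ω|^{α+p}`.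
-- Integrability against the transform of `f` holds since `α + p + 1 < n + p + 1 ≤ N`.
theorem approximatesLeft_of_lt {α r : ℝ} (hα : 0 < α) {n p N : ℕ} (hn : (n : ℝ) - 1 < α)
    (hn' : α < n) (hp : 1 ≤ p) (hN : n + p + 1 ≤ N) {w : ℕ → ℝ} (hs : Summable fun k => |w k|)
    (hw : IsPowerGenerating α p (betaCoeff p (r / α)) w) : ApproximatesLeft α r p N w := by
  intro f hf x
  obtain ⟨C, hC⟩ := exists_symbol_bound hα hp hs hw
  have hNr : (n : ℝ) + p + 1 ≤ N := by exact_mod_cast hN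
  have hpr : (1 : ℝ) ≤ p := by exact_mod_cast hp
  have hN2 : 2 ≤ N := by omega
  set F := 𝓕 fun t => (f t : ℂ) with hFdef
  have hF : Integrable F := hf.integrable_fourier hN2
  have hi1 := hf.integrable_rpow_mul_fourier (a := α + p) (by linarith) (by linarith)
  have hi2 := hf.integrable_rpow_mul_fourier (a := α) (by linarith) (by linarith)
  have hexp : Continuous fun ω : ℝ => Complex.exp (freq ω * x) := by
    have := continuous_freq
    fun_prop
  set S : ℝ → ℝ → ℂ := fun h ω =>
    Complex.exp (r * (freq ω * h)) * ∑' k, (w k : ℂ) * Complex.exp (-(freq ω * h)) ^ k with hS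
  have hint1 : Integrable fun ω => Complex.exp (freq ω * x) * F ω * freq ω ^ (α : ℂ) := by
    have h2 : Measurable fun ω : ℝ => freq ω ^ (α : ℂ) := by
      have := continuous_freq.measurable
      fun_prop
    refine (hi2.const_mul ((2 * Real.pi) ^ α)).mono'
      ((hexp.aestronglyMeasurable.mul hF.aestronglyMeasurable).mul h2.aestronglyMeasurable)
      (.of_forall fun ω => ?_)
    rw [norm_mul, norm_mul, norm_exp_freq_mul, Complex.norm_cpow_real, norm_freq,
      Real.mul_rpow (by positivity) (abs_nonneg _)]
    exact le_of_eq (by ring)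
  have hint2 : ∀ h : ℝ, Integrable fun ω => Complex.exp (freq ω * x) * F ω *
      (((1 / h ^ α : ℝ) : ℂ) * S h ω) := by
    intro h
    have hre : ∀ ω : ℝ, 0 ≤ (freq ω * h).re := fun ω => by simp [freq]
    have h2 : Continuous fun ω : ℝ => S h ω := by
      have hf := continuous_freq
      have h3 : Continuous fun ω : ℝ => ∑' k, (w k : ℂ) * Complex.exp (-(freq ω * h)) ^ k :=
        continuous_tsum (fun k => by fun_prop) hs fun k ω => norm_mul_exp_neg_pow_le w (hre ω) k
      simp only [hS]
      fun_prop
    refine (hF.norm.mul_const (|1 / h ^ α| * ∑' k, |w k|)).mono'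
      ((hexp.aestronglyMeasurable.mul hF.aestronglyMeasurable).mul
        (h2.aestronglyMeasurable.const_mul _)) (.of_forall fun ω => ?_)
    rw [norm_mul, norm_mul, norm_exp_freq_mul, one_mul, norm_mul, Complex.norm_real,
      Real.norm_eq_abs]
    gcongr
    simp only [hS]
    have : ‖Complex.exp (r * (freq ω * h))‖ = 1 := by
      rw [Complex.norm_exp]; simp [freq]
    rw [norm_mul, this, one_mul]
    exact tsum_of_norm_bounded hs.hasSum fun k => norm_mul_exp_neg_pow_le w (hre ω) k
  refine IsBigO.of_bound (∫ ω, C * (2 * Real.pi) ^ (α + p) * (|ω| ^ (α + p) * ‖F ω‖)) ?_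
  filter_upwards [self_mem_nhdsWithin] with h hh
  have hh : 0 < h := hh
  have hhα : 0 < h ^ α := Real.rpow_pos_of_pos hh _
  rw [← Complex.norm_real, Complex.ofReal_sub,
    leftDeriv_eq_integral_fourier hn hn' hα (by linarith) hf,
    leftDiff_eq_integral_fourier hN2 hf hs, ← integral_sub hint1 (hint2 h), Real.norm_eq_abs,
    abs_of_pos (pow_pos hh p), ← integral_mul_const]
  refine norm_integral_le_of_norm_le ((hi1.const_mul _).mul_const _) ?_
  filter_upwards [ae_ne_zero] with ω hω
  have hθ : freq ω * h = ((2 * Real.pi * ω * h : ℝ) : ℂ) * Complex.I := by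
    simp only [freq]; push_cast; ring
  have hb := hC (2 * Real.pi * ω * h)
    (mul_ne_zero (mul_ne_zero Real.two_pi_pos.ne' hω) hh.ne')
  rw [← hθ] at hb
  -- A positive `h` leaves the argument unchanged, so the principal power is multiplicative here.
  have hsplit : (freq ω * h) ^ (α : ℂ) = ((h ^ α : ℝ) : ℂ) * freq ω ^ (α : ℂ) := by
    have hh0 : (h : ℂ) ≠ 0 := by exact_mod_cast hh.ne'
    rw [Complex.ofReal_cpow hh.le, Complex.cpow_def_of_ne_zero (mul_ne_zero (freq_ne_zero hω) hh0),
      Complex.cpow_def_of_ne_zero hh0, Complex.cpow_def_of_ne_zero (freq_ne_zero hω),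
      mul_comm (freq ω), Complex.log_ofReal_mul hh (freq_ne_zero hω), ← Complex.exp_add,
      Complex.ofReal_log hh.le]
    congr 1
    ring
  have hfac : Complex.exp (freq ω * x) * F ω * freq ω ^ (α : ℂ) -
      Complex.exp (freq ω * x) * F ω * (((1 / h ^ α : ℝ) : ℂ) * S h ω) =
      Complex.exp (freq ω * x) * F ω * (((1 / h ^ α : ℝ) : ℂ) *
        ((freq ω * h) ^ (α : ℂ) - S h ω)) := by
    have e2 : ((1 / h ^ α : ℝ) : ℂ) * ((h ^ α : ℝ) : ℂ) = 1 := by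
      rw [← Complex.ofReal_mul, one_div_mul_cancel hhα.ne', Complex.ofReal_one]
    rw [hsplit]
    linear_combination (-(Complex.exp (freq ω * x) * F ω * freq ω ^ (α : ℂ))) * e2
  rw [hfac, norm_mul, norm_mul, norm_exp_freq_mul, one_mul, norm_mul, Complex.norm_real,
    Real.norm_eq_abs, abs_of_pos (by positivity)]
  calc _ ≤ ‖F ω‖ * (1 / h ^ α * (C * |2 * Real.pi * ω * h| ^ (α + p))) := by gcongr
    _ = _ := by
      rw [abs_mul, abs_mul, abs_of_pos Real.two_pi_pos, abs_of_pos hh,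
        Real.mul_rpow (by positivity) hh.le, Real.mul_rpow (by positivity) (abs_nonneg _),
        Real.rpow_add hh, Real.rpow_natCast]
      field_simp

theorem approximatesLeft_iff {α r : ℝ} (hα : 0 < α) {n m p : ℕ} (hn : (n : ℝ) - 1 < α)
    (hn' : α ≤ n) (hp : 1 ≤ p) (hpm : p ≤ m) {β w : ℕ → ℝ} (hs : Summable fun k => |w k|)
    (hw : IsPowerGenerating α p β w) :
    ApproximatesLeft α r p (m + n + 1) w ↔
      ((∀ j ≤ p, β j = betaCoeff p (r / α) j) ∨
        ((∃ k : ℕ, α = 2 * k) ∧ ∀ j ≤ p, β j = -betaCoeff p (r / α) j)) := by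
  refine ⟨eq_betaCoeff_of_approximatesLeft hα hp hw, fun h => ?_⟩
  have hcongr : ∀ {β γ : ℕ → ℝ}, (∀ j ≤ p, β j = γ j) → IsPowerGenerating α p β w →
      IsPowerGenerating α p γ w := by
    intro β γ hβγ hβ x h0 h1
    have : basePoly p γ x = basePoly p β x :=
      Finset.sum_congr rfl fun j hj => by rw [hβγ j (by simpa [Nat.lt_succ_iff] using hj)]
    rw [this]
    exact hβ x h0 h1
  have hb : IsPowerGenerating α p (betaCoeff p (r / α)) w := by
    rcases h with h | ⟨he, h⟩
    · exact hcongr h hw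
    · exact hcongr (fun j hj => by rw [h j hj, neg_neg]) (hw.neg he)
  -- For `α = n` the exponent `b = n - α` of the Fourier argument would be `0`, hence the separate
  -- Taylor proof.
  rcases hn'.lt_or_eq with hlt | rfl
  · exact approximatesLeft_of_lt hα hn hlt hp (by omega) hs hb
  · exact approximatesLeft_natCast (by exact_mod_cast hα) hp (by omega) hs hb

end Grunwald

theorem theorem3p2 (α r : ℝ) (hα : 0 < α) (n m p : ℕ) (hn : (n : ℝ) - 1 < α) (hn' : α ≤ n)
    (hnm : n < m) (hp : 1 ≤ p) (hpm : p ≤ m) :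
    (∀ β w : ℕ → ℝ, Summable (fun k => |w k|) → Grunwald.IsPowerGenerating α p β w →
      (Grunwald.ApproximatesLeft α r p (m + n + 1) w ↔
        ((∀ j ≤ p, β j = Grunwald.betaCoeff p (r / α) j) ∨
          ((∃ k : ℕ, α = 2 * k) ∧ ∀ j ≤ p, β j = -Grunwald.betaCoeff p (r / α) j))) ∧
      (Grunwald.ApproximatesRight α r p (m + n + 1) w ↔
        ((∀ j ≤ p, β j = Grunwald.betaCoeff p (r / α) j) ∨
          ((∃ k : ℕ, α = 2 * k) ∧ ∀ j ≤ p, β j = -Grunwald.betaCoeff p (r / α) j)))) ∧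
    (∀ j ≤ p, (∀ l ≤ p, l ≠ j → r / α ≠ l) →
      Grunwald.betaCoeff p (r / α) j = Grunwald.betaCoeff' p (r / α) j) ∧
    (r = 0 → ∀ z : ℂ,
      Grunwald.basePoly p (Grunwald.betaCoeff p (r / α)) z = Grunwald.lubichPoly p z) := by
  refine ⟨fun β w hs hw => ?_, fun j _ h => Grunwald.betaCoeff_eq_betaCoeff' h, ?_⟩
  · rw [Grunwald.approximatesRight_iff_approximatesLeft]
    exact ⟨Grunwald.approximatesLeft_iff hα hn hn' hp hpm hs hw,
      Grunwald.approximatesLeft_iff hα hn hn' hp hpm hs hw⟩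
  · rintro rfl z
    rw [zero_div]
    exact Grunwald.basePoly_betaCoeff_zero hp z
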